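/- Let $n\ge 1$ be an integer, let $h(t)=(t,\cos t,\sin t)\in\mathbb{R}^3$, $h_n(t)=h(2\pi t/n)$ and $\mathcal H_n=\{h_n(t)\mid t\in\mathbb Z\}$. A Delaunay cell of $\mathcal H_n$ is a nonempty set consisting of all points of $\mathcal H_n$ on some sphere that has no point of $\mathcal H_n$ in its interior; it is a Delaunay simplex if its points are affinely independent. Let $V_n(t)$ be the closed Voronoi region of $h_n(t)$ with respect to $\mathcal H_n$, and let $F_k=V_n(t)\cap V_n(t+k)$. (a) Every Delaunay cell of $\mathcal H_n$ is a simplex (so that the Delaunay subdivision of $\mathcal H_n$ is a triangulation), and for all integers $a<b<c<d$, the points $h_n(a),h_n(b),h_n(c),h_n(d)$ are the vertices of a simplex in the Delaunay triangulation of $\mathcal H_n$ if and only if $b-a=d-c=1$ and $d-a\le n$. (b) For every integer $t$, the region $V_n(t)$ is a three-dimensional convex polyhedron with exactly $2n$ facets, namely the sets $F_k$ with $1\le|k|\le n$. They form $n$ symmetric pairs: some involutive isometry of $\mathbb{R}^3$ maps $V_n(t)$ to itself and every $F_k$ to $F_{-k}$. (c) If $n\ge 4$, then for every integer $t$: $F_{\pm1}$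 are unbounded $(2n-2)$-gons, each bounded by $2n-4$ segments and two parallel rays; $F_{\pm2}$ are triangles; $F_k$ with $3\le|k|\le n-2$ are quadrilaterals; $F_{\pm(n-1)}$ are unbounded quadrilaterals, each bounded by two segments and two parallel rays; and $F_{\pm n}$ are wedges in parallel planes, each bounded by a pair of rays. The union $F_1\cup F_{-1}$ contains all vertices of $V_n(t)$. The facet $F_1$ is adjacent to (shares an edge with) every other facet except $F_{-n}$, and $F_{-1}$ is adjacent to every other facet except $F_n$; two distinct facets $F_i,F_j$ with $|i|,|j|\ge2$ are adjacent if and only if $|i-j|=1$. -/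

import Mathlib

noncomputable section

/-- Euclidean three-space. -/
abbrev E3 : Type := EuclideanSpace ℝ (Fin 3)

/-- The regular circular helix `h(t) = (t, cos t, sin t)`. -/
def helix (t : ℝ) : E3 := !₂[t, Real.cos t, Real.sin t]

/-- The evenly spaced points `h_n(t) = h(2πt/n)`, `t ∈ ℤ`. -/
def helixPt (n : ℕ) (t : ℤ) : E3 := helix (2 * Real.pi * (t : ℝ) / (n : ℝ))

/-- The infinite point set `H_n = {h_n(t) | t ∈ ℤ}`. -/
def helixSet (n : ℕ) : Set E3 := Set.range (helixPt n)

/-- `T` is (the set of sites of) a cell of the Delaunay subdivision of `S`: there is a sphere with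
no point of `S` in its interior, and `T` is the nonempty set of all points of `S` on it. -/
def IsDelaunayCell (S T : Set E3) : Prop :=
  T.Nonempty ∧ ∃ (c : E3) (r : ℝ), (∀ p ∈ S, r ≤ dist p c) ∧ T = {p ∈ S | dist p c = r}

/-- `T` is the vertex set of a simplex of the Delaunay subdivision of `S`. -/
def IsDelaunaySimplex (S T : Set E3) : Prop :=
  IsDelaunayCell S T ∧ AffineIndependent ℝ (fun p : T => (p : E3))

/-- The Delaunay subdivision of `S` is a triangulation: every one of its cells is a simplex. -/
def DelaunayIsTriangulation (S : Set E3) : Prop :=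
  ∀ T : Set E3, IsDelaunayCell S T → IsDelaunaySimplex S T

/-- The (closed) Voronoi region of the site `p` of `S`. -/
def voronoiRegion (S : Set E3) (p : E3) : Set E3 := {x | ∀ q ∈ S, dist x p ≤ dist x q}

/-- The Voronoi region `V_n(t)` of `h_n(t)` with respect to `H_n`. -/
def helixRegion (n : ℕ) (t : ℤ) : Set E3 := voronoiRegion (helixSet n) (helixPt n t)

/-- The intersection `V_n(t) ∩ V_n(t + k)`. -/
def helixFacet (n : ℕ) (t k : ℤ) : Set E3 := helixRegion n t ∩ helixRegion n (t + k)

/-- A (convex, possibly unbounded) polyhedron: an intersection of finitely many closed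
half-spaces. -/
def IsPolyhedron (A : Set E3) : Prop :=
  ∃ s : Finset (E3 × ℝ), (∀ p ∈ s, p.1 ≠ 0) ∧ A = {x | ∀ p ∈ s, inner ℝ p.1 x ≤ p.2}

/-- The dimension of (the affine hull of) a nonempty set. -/
def affDim (A : Set E3) : ℕ := Module.finrank ℝ (vectorSpan ℝ A)

/-- `B` is a `k`-dimensional face of the polyhedron `A`. -/
def IsFace (A B : Set E3) (k : ℕ) : Prop :=
  B.Nonempty ∧ IsExposed ℝ A B ∧ affDim B = k

/-- The facets of a three-dimensional polyhedron. -/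
def facets (A : Set E3) : Set (Set E3) := {F | IsFace A F 2}

/-- The edges (one-dimensional faces) of a polyhedron or polygon. -/
def edges (A : Set E3) : Set (Set E3) := {e | IsFace A e 1}

/-- `e` is a nondegenerate line segment. -/
def IsSegment (e : Set E3) : Prop := ∃ p q : E3, p ≠ q ∧ e = segment ℝ p q

/-- The closed ray from `p` in direction `v`. -/
def rayFrom (p v : E3) : Set E3 := {x | ∃ s : ℝ, 0 ≤ s ∧ x = p + s • v}

/-- `e` is a ray. -/
def IsRay (e : Set E3) : Prop := ∃ p v : E3, v ≠ 0 ∧ e = rayFrom p v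

/-- The polygon `F` is bounded by exactly `s` segments and `r` rays. -/
def BoundedBy (F : Set E3) (s r : ℕ) : Prop :=
  (∀ e ∈ edges F, IsSegment e ∨ IsRay e) ∧
    {e ∈ edges F | IsSegment e}.encard = s ∧ {e ∈ edges F | IsRay e}.encard = r

/-- The rays bounding the polygon `F` are all parallel. -/
def ParallelRays (F : Set E3) : Prop :=
  ∃ v : E3, v ≠ 0 ∧ ∀ e ∈ edges F, IsRay e → ∃ p : E3, e = rayFrom p v

/-- Two facets are adjacent if they share an edge. -/
def AdjacentFacets (F G : Set E3) : Prop := affDim (F ∩ G) = 1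

end

open Real Set


/-! For a centre x, the squared distance to h(τ) is, up to a constant depending on x, the power τ²
minus a linear form in τ, cos τ, sin τ. Everything is governed by the sets `nearest n x` of indices
where this power is least among the sites: Delaunay cells are their images, and the faces of the
Voronoi regions are the sets `voronoiFace n (nearest n x)`.

Which sets can occur? The increment of the power over one turn increases with its starting index, so
a nearest set spans at most n. Within one turn, a power that is low, high, low, high, low would, by
the mean value theorem applied twice and a wrap-around, give its second derivative, a trigonometric
polynomial of degree one, four alternating signs in a period, which is impossible
(`helixPower_no_alternation`). Hence among three nearest indices two are consecutive, four have the
form a, a+1, c, c+1, and there are never five.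

All sets so permitted do occur. Spheres centred on the axis of a half-turn of the helix realise the
pairs and quadruples (`exists_nearest_symmetric`). For n ≥ 3, midpoints of two such centres realise
the triples shorter than a turn, and points on unbounded edges realise the triples that span a full
turn.

Nearest sites are affinely independent, so a face with m nearest sites has dimension 4 - m
(`affDim_voronoiFace`). Facets, edges and vertices thus correspond to pairs, triples and quadruples,
an edge being a ray exactly when its triple spans a turn. The shapes and adjacencies of the facets
reduce to counting integers. -/

/-! ### Sign changes of the power along one turn -/

/-- Up to a factor `4`, the product of the sines of half the differences. -/
theorem sin_add_sin_add_sin_pos {x y z : ℝ} (hxy : x < y) (hyz : y < z) (hzx : z < x + 2 * π) :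
    0 < sin (y - x) + sin (z - y) + sin (x - z) := by
  have key : sin (y - x) + sin (z - y) + sin (x - z)
      = 4 * (sin ((y - x) / 2) * sin ((z - y) / 2) * sin ((z - x) / 2)) := by
    set p := (y - x) / 2 with hp
    set q := (z - y) / 2 with hq
    have e1 : y - x = 2 * p := by rw [hp]; ring
    have e2 : z - y = 2 * q := by rw [hq]; ring
    have e3 : x - z = -(2 * (p + q)) := by rw [hp, hq]; ring
    have e4 : (z - x) / 2 = p + q := by rw [hp, hq]; ring
    rw [e1, e2, e3, e4, sin_neg, sin_two_mul, sin_two_mul, sin_two_mul, sin_add, cos_add]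
    linear_combination (-2 * sin p * cos p) * sin_sq_add_cos_sq q
      + (-2 * sin q * cos q) * sin_sq_add_cos_sq p
  rw [key]
  have h1 : 0 < sin ((y - x) / 2) := sin_pos_of_pos_of_lt_pi (by linarith) (by linarith)
  have h2 : 0 < sin ((z - y) / 2) := sin_pos_of_pos_of_lt_pi (by linarith) (by linarith)
  have h3 : 0 < sin ((z - x) / 2) := sin_pos_of_pos_of_lt_pi (by linarith) (by linarith)
  positivity

/-- A trigonometric polynomial of degree one does not change sign four times in a period. -/
theorem trig_no_alternation {b c e x y z w : ℝ} (hxy : x < y) (hyz : y < z) (hzw : z < w)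
    (hwx : w < x + 2 * π) (hx : b * cos x + c * sin x + e ≤ 0)
    (hy : 0 ≤ b * cos y + c * sin y + e) (hz : b * cos z + c * sin z + e ≤ 0)
    (hw : 0 < b * cos w + c * sin w + e) : False := by
  have d1 := sin_add_sin_add_sin_pos hyz hzw (by linarith)
  have d2 := sin_add_sin_add_sin_pos (hxy.trans hyz) hzw (by linarith)
  have d3 := sin_add_sin_add_sin_pos hxy (hyz.trans hzw) (by linarith)
  have d4 := sin_add_sin_add_sin_pos hxy hyz (by linarith)
  have key : (sin (z - y) + sin (w - z) + sin (y - w)) * (b * cos x + c * sin x + e)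
      - (sin (z - x) + sin (w - z) + sin (x - w)) * (b * cos y + c * sin y + e)
      + (sin (y - x) + sin (w - y) + sin (x - w)) * (b * cos z + c * sin z + e)
      - (sin (y - x) + sin (z - y) + sin (x - z)) * (b * cos w + c * sin w + e) = 0 := by
    simp only [sin_sub]; ring
  nlinarith [mul_nonneg d1.le (neg_nonneg.2 hx), mul_nonneg d2.le hy,
    mul_nonneg d3.le (neg_nonneg.2 hz), mul_pos d4 hw]

theorem exists_hasDerivAt_nonneg {f f' : ℝ → ℝ} (hf : ∀ t, HasDerivAt f (f' t) t) {a b : ℝ}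
    (hab : a < b) (h : f a ≤ f b) : ∃ c, a < c ∧ c < b ∧ 0 ≤ f' c := by
  obtain ⟨c, hc, e⟩ := exists_hasDerivAt_eq_slope f f' hab
    (fun t _ => (hf t).continuousAt.continuousWithinAt) (fun t _ => hf t)
  exact ⟨c, hc.1, hc.2, e ▸ div_nonneg (by linarith) (by linarith)⟩

theorem exists_hasDerivAt_nonpos {f f' : ℝ → ℝ} (hf : ∀ t, HasDerivAt f (f' t) t) {a b : ℝ}
    (hab : a < b) (h : f b ≤ f a) : ∃ c, a < c ∧ c < b ∧ f' c ≤ 0 := by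
  obtain ⟨c, hc, e⟩ := exists_hasDerivAt_eq_slope f f' hab
    (fun t _ => (hf t).continuousAt.continuousWithinAt) (fun t _ => hf t)
  exact ⟨c, hc.1, hc.2, e ▸ div_nonpos_of_nonpos_of_nonneg (by linarith) (by linarith)⟩

theorem exists_hasDerivAt_pos {f f' : ℝ → ℝ} (hf : ∀ t, HasDerivAt f (f' t) t) {a b : ℝ}
    (hab : a < b) (h : f a < f b) : ∃ c, a < c ∧ c < b ∧ 0 < f' c := by
  obtain ⟨c, hc, e⟩ := exists_hasDerivAt_eq_slope f f' hab
    (fun t _ => (hf t).continuousAt.continuousWithinAt) (fun t _ => hf t)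
  exact ⟨c, hc.1, hc.2, e ▸ div_pos (by linarith) (by linarith)⟩

/-- The power (up to a constant) of the point `h(τ)` of the helix with respect to a sphere centred
at `x`. -/
noncomputable def helixPower (x : E3) (τ : ℝ) : ℝ := τ ^ 2 - 2 * (x 0 * τ + x 1 * cos τ + x 2 * sin τ)

/-- On one turn of the helix, a sphere cannot be left and entered as
in, out, in, out, in. -/
theorem helixPower_no_alternation (x : E3) (r : ℝ) {t₀ t₁ t₂ t₃ t₄ : ℝ} (h01 : t₀ < t₁)
    (h12 : t₁ < t₂) (h23 : t₂ < t₃) (h34 : t₃ < t₄) (h40 : t₄ ≤ t₀ + 2 * π)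
    (h0 : helixPower x t₀ ≤ r) (h1 : r ≤ helixPower x t₁) (h2 : helixPower x t₂ ≤ r)
    (h3 : r ≤ helixPower x t₃) (h4 : helixPower x t₄ ≤ r) : False := by
  set f' : ℝ → ℝ := fun τ => 2 * τ - 2 * (x 0 - x 1 * sin τ + x 2 * cos τ) with hf'
  set f'' : ℝ → ℝ := fun τ => 2 - 2 * (-(x 1) * cos τ - x 2 * sin τ) with hf''
  have df : ∀ τ, HasDerivAt (helixPower x) (f' τ) τ := fun τ => by
    have := ((hasDerivAt_id τ).pow 2).sub
      (((((hasDerivAt_id τ).const_mul (x 0)).add ((hasDerivAt_cos τ).const_mul (x 1))).add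
        ((hasDerivAt_sin τ).const_mul (x 2))).const_mul 2)
    refine this.congr_deriv ?_
    simp [hf']; ring
  have df' : ∀ τ, HasDerivAt f' (f'' τ) τ := fun τ => by
    have := ((hasDerivAt_id τ).const_mul 2).sub
      ((((hasDerivAt_const τ (x 0)).sub ((hasDerivAt_sin τ).const_mul (x 1))).add
        ((hasDerivAt_cos τ).const_mul (x 2))).const_mul 2)
    refine this.congr_deriv ?_
    simp [hf'']; ring
  obtain ⟨s₀, a0, b0, c0⟩ := exists_hasDerivAt_nonneg df h01 (h0.trans h1)
  obtain ⟨s₁, a1, b1, c1⟩ := exists_hasDerivAt_nonpos df h12 (h2.trans h1)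
  obtain ⟨s₂, a2, b2, c2⟩ := exists_hasDerivAt_nonneg df h23 (h2.trans h3)
  obtain ⟨s₃, a3, b3, c3⟩ := exists_hasDerivAt_nonpos df h34 (h4.trans h3)
  -- The quadratic term raises the derivative by 4π per turn. This supplies the missing fourth
  -- interval and the one strict inequality.
  have c4 : 0 < f' (s₀ + 2 * π) := by
    have : f' (s₀ + 2 * π) = f' s₀ + 4 * π := by simp only [hf', sin_add_two_pi, cos_add_two_pi]; ring
    have := pi_pos
    linarith
  obtain ⟨u₀, p0, q0, r0⟩ := exists_hasDerivAt_nonpos df' (b0.trans a1) (c1.trans c0)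
  obtain ⟨u₁, p1, q1, r1⟩ := exists_hasDerivAt_nonneg df' (b1.trans a2) (c1.trans c2)
  obtain ⟨u₂, p2, q2, r2⟩ := exists_hasDerivAt_nonpos df' (b2.trans a3) (c3.trans c2)
  obtain ⟨u₃, p3, q3, r3⟩ := exists_hasDerivAt_pos df' (by linarith : s₃ < s₀ + 2 * π)
    (c3.trans_lt c4)
  refine trig_no_alternation (b := 2 * x 1) (c := 2 * x 2) (e := 2) (q0.trans p1) (q1.trans p2)
    (q2.trans p3) (by linarith) ?_ ?_ ?_ ?_ <;> simp only [hf''] at r0 r1 r2 r3 <;> linarith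

/-! ### The even power u² + B cos u -/

/-- `sin u / u` is strictly decreasing on `(0, π]`. -/
theorem mul_sin_lt_mul_sin {u v : ℝ} (hu : 0 < u) (huv : u < v) (hv : v ≤ π) :
    u * sin v < v * sin u := by
  have h := strictConcaveOn_sin_Icc.2 (⟨le_rfl, pi_pos.le⟩ : (0 : ℝ) ∈ Icc 0 π)
    (⟨by linarith, hv⟩ : v ∈ Icc 0 π) (by linarith : (0 : ℝ) < v).ne
    (sub_pos.2 ((div_lt_one (by linarith)).2 huv)) (div_pos hu (by linarith))
    (sub_add_cancel 1 (u / v))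
  have hv0 : v ≠ 0 := by linarith
  simp only [smul_eq_mul, sin_zero, mul_zero, zero_add, div_mul_cancel₀ u hv0] at h
  rw [div_mul_eq_mul_div, div_lt_iff₀ (by linarith)] at h
  linarith

/-- Equality of the values at u₁ and u₂ determines B, and Rolle gives a critical point ξ between
them. Critical points satisfy 2u = B sin u, and since sin u / u decreases there is only one in (0,
π): the function falls up to ξ and rises after it. -/
theorem exists_even_power {u₁ u₂ : ℝ} (h1 : 0 ≤ u₁) (h12 : u₁ < u₂) (h2 : u₂ ≤ π) :
    ∃ B : ℝ, u₁ ^ 2 + B * cos u₁ = u₂ ^ 2 + B * cos u₂ ∧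
      ∀ u, 0 ≤ u → u ≤ π → u < u₁ ∨ u₂ < u → u₂ ^ 2 + B * cos u₂ < u ^ 2 + B * cos u := by
  have hc : cos u₂ < cos u₁ := cos_lt_cos_of_nonneg_of_le_pi h1 h2 h12
  obtain ⟨B, hB⟩ : ∃ B : ℝ, u₁ ^ 2 + B * cos u₁ = u₂ ^ 2 + B * cos u₂ := by
    refine ⟨(u₂ ^ 2 - u₁ ^ 2) / (cos u₁ - cos u₂), ?_⟩
    have : cos u₁ - cos u₂ ≠ 0 := by linarith
    field_simp
    ring
  refine ⟨B, hB, ?_⟩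
  set f : ℝ → ℝ := fun u => u ^ 2 + B * cos u with hf
  have df : ∀ u, HasDerivAt f (2 * u - B * sin u) u := fun u => by
    refine (((hasDerivAt_id u).pow 2).add ((hasDerivAt_cos u).const_mul B)).congr_deriv ?_
    simp; ring
  have cf : Continuous f := by rw [hf]; fun_prop
  obtain ⟨ξ, ⟨hξ1, hξ2⟩, hξ⟩ := exists_hasDerivAt_eq_zero h12 cf.continuousOn hB
    (fun u _ => df u)
  have sξ : 0 < sin ξ := sin_pos_of_pos_of_lt_pi (by linarith) (by linarith)
  have hdown : StrictAntiOn f (Icc 0 ξ) := by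
    refine strictAntiOn_of_deriv_neg (convex_Icc _ _) cf.continuousOn fun u hu => ?_
    rw [interior_Icc] at hu
    rw [(df u).deriv]
    have := mul_sin_lt_mul_sin hu.1 hu.2 (by linarith)
    -- Multiplying by sin ξ > 0 allows B sin ξ to be replaced by 2ξ, so the sign of B never matters.
    have e : (2 * u - B * sin u) * sin ξ < 0 := by
      have : (2 * u - B * sin u) * sin ξ = 2 * (u * sin ξ - ξ * sin u) := by
        linear_combination sin u * hξ
      rw [this]
      linarith
    exact neg_of_mul_neg_left e sξ.le
  have hup : StrictMonoOn f (Icc ξ π) := by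
    refine strictMonoOn_of_deriv_pos (convex_Icc _ _) cf.continuousOn fun u hu => ?_
    rw [interior_Icc] at hu
    rw [(df u).deriv]
    have := mul_sin_lt_mul_sin (by linarith) hu.1 hu.2.le
    have e : 0 < (2 * u - B * sin u) * sin ξ := by
      have : (2 * u - B * sin u) * sin ξ = 2 * (u * sin ξ - ξ * sin u) := by
        linear_combination sin u * hξ
      rw [this]
      linarith
    exact pos_of_mul_pos_left e sξ.le
  rintro u hu0 huπ (h | h)
  · rw [← hB]
    exact hdown ⟨hu0, by linarith⟩ ⟨h1, hξ1.le⟩ h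
  · exact hup ⟨hξ2.le, h2⟩ ⟨by linarith, huπ⟩ h

/-! ### Powers of the sites and constraints on nearest sets -/

/-- The scalar product of `v` with the `s`-th point of the helix. -/
noncomputable def helixDot (n : ℕ) (v : E3) (s : ℤ) : ℝ :=
  v 0 * (2 * π * (s : ℝ) / (n : ℝ)) + v 1 * cos (2 * π * (s : ℝ) / (n : ℝ))
    + v 2 * sin (2 * π * (s : ℝ) / (n : ℝ))

theorem inner_helixPt (n : ℕ) (v : E3) (s : ℤ) : inner ℝ v (helixPt n s) = helixDot n v s := by
  simp [helixPt, helix, helixDot, PiLp.inner_apply, Fin.sum_univ_three]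
  ring

/-- The power (up to a constant) of the `s`-th point with respect to a sphere centred at `x`. -/
noncomputable def ptPower (n : ℕ) (x : E3) (s : ℤ) : ℝ := helixPower x (2 * π * (s : ℝ) / (n : ℝ))

theorem ptPower_eq (n : ℕ) (x : E3) (s : ℤ) :
    ptPower n x s = (2 * π * (s : ℝ) / (n : ℝ)) ^ 2 - 2 * helixDot n x s := by
  rw [ptPower, helixPower, helixDot]

theorem norm_sq_helixPt (n : ℕ) (s : ℤ) :
    ‖helixPt n s‖ ^ 2 = (2 * π * (s : ℝ) / (n : ℝ)) ^ 2 + 1 := by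
  rw [EuclideanSpace.norm_sq_eq, Fin.sum_univ_three]
  simp [helixPt, helix, add_assoc, -Real.norm_eq_abs, Real.norm_eq_abs, sq_abs, mul_pow, div_pow]

theorem dist_helixPt_sq (n : ℕ) (x : E3) (s : ℤ) :
    dist x (helixPt n s) ^ 2 = ptPower n x s + (‖x‖ ^ 2 + 1) := by
  rw [dist_eq_norm, norm_sub_sq_real, inner_helixPt, norm_sq_helixPt, ptPower_eq]
  ring

theorem dist_helixPt_le_iff (n : ℕ) (x : E3) (s r : ℤ) :
    dist x (helixPt n s) ≤ dist x (helixPt n r) ↔ ptPower n x s ≤ ptPower n x r := by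
  rw [← sq_le_sq₀ dist_nonneg dist_nonneg, dist_helixPt_sq, dist_helixPt_sq, add_le_add_iff_right]

theorem helixDot_add_smul (n : ℕ) (x v : E3) (c : ℝ) (s : ℤ) :
    helixDot n (x + c • v) s = helixDot n x s + c * helixDot n v s := by
  simp [helixDot]; ring

theorem ptPower_add_smul (n : ℕ) (x v : E3) (c : ℝ) (s : ℤ) :
    ptPower n (x + c • v) s = ptPower n x s - 2 * c * helixDot n v s := by
  rw [ptPower_eq, ptPower_eq, helixDot_add_smul]; ring

theorem angle_lt {n : ℕ} (hn : 1 ≤ n) {s r : ℤ} (h : s < r) :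
    2 * π * (s : ℝ) / (n : ℝ) < 2 * π * (r : ℝ) / (n : ℝ) := by
  have : (0 : ℝ) < n := by exact_mod_cast hn
  have : (s : ℝ) < r := by exact_mod_cast h
  have := pi_pos
  gcongr

theorem angle_add_period {n : ℕ} (hn : 1 ≤ n) (s : ℤ) :
    2 * π * ((s + n : ℤ) : ℝ) / (n : ℝ) = 2 * π * (s : ℝ) / (n : ℝ) + 2 * π := by
  have : (n : ℝ) ≠ 0 := by positivity
  push_cast
  field_simp

theorem ptPower_add_period {n : ℕ} (hn : 1 ≤ n) (x : E3) (s : ℤ) :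
    ptPower n x (s + n) - ptPower n x s =
      4 * π * (2 * π * (s : ℝ) / (n : ℝ)) + 4 * π * (π - x 0) := by
  rw [ptPower, ptPower, angle_add_period hn, helixPower, helixPower, cos_add_two_pi,
    sin_add_two_pi]
  ring

/-- The trigonometric terms cancel over a turn, leaving an increment affine in the index with
positive slope. This convexity at step n controls all sites more than a turn away. -/
theorem ptPower_add_period_lt {n : ℕ} (hn : 1 ≤ n) (x : E3) {s r : ℤ} (h : s < r) :
    ptPower n x (s + n) - ptPower n x s < ptPower n x (r + n) - ptPower n x r := by
  rw [ptPower_add_period hn, ptPower_add_period hn]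
  have := angle_lt hn h
  have := pi_pos
  gcongr

/-- The indices of the points of the helix nearest to `x`. -/
def nearest (n : ℕ) (x : E3) : Set ℤ := {s | ∀ r, ptPower n x s ≤ ptPower n x r}

theorem nearest_eq {n : ℕ} {x : E3} {s r : ℤ} (hs : s ∈ nearest n x) (hr : r ∈ nearest n x) :
    ptPower n x s = ptPower n x r := le_antisymm (hs r) (hr s)

theorem mem_nearest_of_le {n : ℕ} {x : E3} {s r : ℤ} (hs : s ∈ nearest n x)
    (h : ptPower n x r ≤ ptPower n x s) : r ∈ nearest n x := fun q => h.trans (hs q)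

theorem lt_of_notMem_nearest {n : ℕ} {x : E3} {s r : ℤ} (hs : s ∈ nearest n x)
    (hr : r ∉ nearest n x) : ptPower n x s < ptPower n x r :=
  lt_of_not_ge fun h => hr (mem_nearest_of_le hs h)

/-- Otherwise the turn that starts at i does not lower the power and the later turn that ends at j
does not raise it, against the growth of the increments. -/
theorem sub_le_of_mem_nearest {n : ℕ} (hn : 1 ≤ n) {x : E3} {i j : ℤ} (hi : i ∈ nearest n x)
    (hj : j ∈ nearest n x) : j - i ≤ n := by
  by_contra! h
  have h1 := hi (i + n)
  have h2 := hj (j - n)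
  have h3 := ptPower_add_period_lt hn x (s := i) (r := j - n) (by omega)
  rw [sub_add_cancel] at h3
  linarith

/-- By convexity at step n, a nonnegative increment over the first turn on either side persists
further out. Only finitely many sites therefore have to be compared with p, which makes the regions
polyhedra and nearness stable under small moves. -/
theorem mem_nearest_of_near {n : ℕ} (hn : 1 ≤ n) {x : E3} {p : ℤ}
    (h : ∀ s, |s - p| ≤ (n : ℤ) → ptPower n x p ≤ ptPower n x s) : p ∈ nearest n x := by
  have hup : ∀ k : ℕ, ptPower n x p ≤ ptPower n x (p + k) := by
    intro k
    induction k using Nat.strong_induction_on with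
    | _ k ih =>
      rcases le_or_gt k n with hk | hk
      · exact h _ (by rw [add_sub_cancel_left, abs_of_nonneg (by positivity)]; exact_mod_cast hk)
      · have h1 := ih (k - n) (by omega)
        have h2 := ptPower_add_period_lt hn x (s := p) (r := p + (k - n : ℕ)) (by omega)
        have h3 := h (p + n) (by simp)
        rw [show p + ((k - n : ℕ) : ℤ) + n = p + k by omega] at h2
        linarith
  have hdown : ∀ k : ℕ, ptPower n x p ≤ ptPower n x (p - k) := by
    intro k
    induction k using Nat.strong_induction_on with
    | _ k ih =>
      rcases le_or_gt k n with hk | hk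
      · exact h _ (by rw [sub_sub_cancel_left, abs_neg, abs_of_nonneg (by positivity)]; exact_mod_cast hk)
      · have h1 := ih (k - n) (by omega)
        have h2 := ptPower_add_period_lt hn x (s := p - k) (r := p - n) (by omega)
        have h3 := h (p - n) (by simp)
        rw [show p - (k : ℤ) + n = p - (k - n : ℕ) by omega, sub_add_cancel] at h2
        linarith
  intro s
  rcases le_total p s with hs | hs
  · have := hup (s - p).toNat
    rwa [show p + ((s - p).toNat : ℤ) = s by omega] at this
  · have := hdown (p - s).toNat
    rwa [show p - ((p - s).toNat : ℤ) = s by omega] at this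

theorem finite_nearest {n : ℕ} (hn : 1 ≤ n) (x : E3) : (nearest n x).Finite := by
  rcases (nearest n x).eq_empty_or_nonempty with h | ⟨p, hp⟩
  · simp [h]
  · refine (finite_Icc (p - n) (p + n)).subset fun s hs => ?_
    have := sub_le_of_mem_nearest hn hs hp
    have := sub_le_of_mem_nearest hn hp hs
    constructor <;> omega

theorem ptPower_no_alternation {n : ℕ} (hn : 1 ≤ n) {x : E3} {a b c d e : ℤ} (hab : a < b)
    (hbc : b < c) (hcd : c < d) (hde : d < e) (ha : a ∈ nearest n x) (hc : c ∈ nearest n x)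
    (he : e ∈ nearest n x) : False := by
  have h := sub_le_of_mem_nearest hn ha he
  have h5 : 2 * π * (e : ℝ) / (n : ℝ) ≤ 2 * π * (a : ℝ) / (n : ℝ) + 2 * π := by
    rw [← angle_add_period hn]
    rcases (show e ≤ a + n by omega).eq_or_lt with h | h
    · rw [h]
    · exact (angle_lt hn h).le
  exact helixPower_no_alternation x (ptPower n x a) (angle_lt hn hab) (angle_lt hn hbc)
    (angle_lt hn hcd) (angle_lt hn hde) h5 le_rfl (ha b) (hc a) (ha d) (he a)

theorem consecutive_of_mem_nearest {n : ℕ} (hn : 1 ≤ n) {x : E3} {p q r : ℤ} (hpq : p < q)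
    (hqr : q < r) (hp : p ∈ nearest n x) (hq : q ∈ nearest n x) (hr : r ∈ nearest n x) :
    q = p + 1 ∨ r = q + 1 := by
  by_contra! h
  exact ptPower_no_alternation hn (show p < p + 1 by omega) (show p + 1 < q by omega)
    (show q < q + 1 by omega) (show q + 1 < r by omega) hp hq hr

theorem nearest_eq_of_four_mem {n : ℕ} (hn : 1 ≤ n) {x : E3} {a b c d : ℤ} (hab : a < b)
    (hbc : b < c) (hcd : c < d) (ha : a ∈ nearest n x) (hb : b ∈ nearest n x)
    (hc : c ∈ nearest n x) (hd : d ∈ nearest n x) :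
    b = a + 1 ∧ d = c + 1 ∧ d - a ≤ n ∧ nearest n x = {a, b, c, d} := by
  refine ⟨?_, ?_, sub_le_of_mem_nearest hn ha hd, ?_⟩
  · by_contra h
    exact ptPower_no_alternation hn (show a < a + 1 by omega) (show a + 1 < b by omega) hbc hcd
      ha hb hd
  · by_contra h
    exact ptPower_no_alternation hn hab hbc (show c < c + 1 by omega) (show c + 1 < d by omega)
      ha hc hd
  · ext s
    simp only [mem_insert_iff, mem_singleton_iff]
    constructor
    · intro hs
      -- The intermediate indices of an alternation may themselves be nearest, since all
      -- inequalities there are weak. Five nearest indices therefore already form one.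
      by_contra! h
      rcases lt_or_gt_of_ne h.1 with h1 | h1
      · exact ptPower_no_alternation hn h1 hab hbc hcd hs hb hd
      rcases lt_or_gt_of_ne h.2.1 with h2 | h2
      · exact ptPower_no_alternation hn h1 h2 hbc hcd ha hb hd
      rcases lt_or_gt_of_ne h.2.2.1 with h3 | h3
      · exact ptPower_no_alternation hn hab h2 h3 hcd ha hs hd
      rcases lt_or_gt_of_ne h.2.2.2 with h4 | h4
      · exact ptPower_no_alternation hn hab hbc h3 h4 ha hc hd
      · exact ptPower_no_alternation hn hab hbc hcd h4 ha hc hs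
    · rintro (rfl | rfl | rfl | rfl) <;> assumption

/-! ### Realising pairs and quadruples as nearest sets -/

/-- The centre lies on the axis of the half-turn exchanging s and M - s, so the power is an even
function of 2s - M, of the form u² + B cos u with u = π(2s - M)/n. All 2s - M have the parity of e₂;
as e₂ ≤ e₁ + 2, none lies strictly between e₁ and e₂ in absolute value. If e₁ has the other parity,
only e₂ is attained. -/
theorem exists_nearest_symmetric {n : ℕ} (hn : 1 ≤ n) {M e₁ e₂ : ℤ} (h1 : 0 ≤ e₁) (h12 : e₁ < e₂)
    (h2 : e₂ ≤ n) (h21 : e₂ ≤ e₁ + 2) (hM : Even (M + e₂)) :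
    ∃ x : E3, nearest n x = {s | |2 * s - M| = e₁ ∨ |2 * s - M| = e₂} := by
  have n0 : (0 : ℝ) < n := by exact_mod_cast hn
  have c1 : (0 : ℝ) ≤ e₁ := by exact_mod_cast h1
  have c12 : (e₁ : ℝ) < e₂ := by exact_mod_cast h12
  have c2 : (e₂ : ℝ) ≤ n := by exact_mod_cast h2
  have π0 := pi_pos
  obtain ⟨B, hB, hB'⟩ := exists_even_power (u₁ := π * e₁ / n) (u₂ := π * e₂ / n) (by positivity)
    (by gcongr) (by rw [div_le_iff₀ n0]; gcongr)
  set g : ℤ → ℝ := fun j => (π * j / n) ^ 2 + B * cos (π * j / n) with hg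
  have g_neg : ∀ j, g (-j) = g j := fun j => by
    simp only [hg]; push_cast
    rw [show π * -(j : ℝ) / n = -(π * j / n) by ring, cos_neg]; ring
  have g_shift : ∀ j, g (j + 2 * n) = g j + 4 * π ^ 2 * (j + n) / n := fun j => by
    simp only [hg]; push_cast
    rw [show π * ((j : ℝ) + 2 * n) / n = π * j / n + 2 * π by field_simp, cos_add_two_pi]
    field_simp; ring
  have main : ∀ k : ℕ, Even ((k : ℤ) + e₂) → g e₂ ≤ g k ∧ ((k : ℤ) ≠ e₁ → (k : ℤ) ≠ e₂ → g e₂ < g k) := by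
    intro k
    induction k using Nat.strong_induction_on with
    | _ k ih =>
      intro hk
      rcases le_or_gt k n with hkn | hkn
      · by_cases hk1 : (k : ℤ) = e₁
        · rw [hk1]; exact ⟨hB.ge, fun h => (h rfl).elim⟩
        by_cases hk2 : (k : ℤ) = e₂
        · rw [hk2]; exact ⟨le_rfl, fun _ h => (h rfl).elim⟩
        have hk3 : (k : ℤ) < e₁ ∨ e₂ < (k : ℤ) := by
          by_contra! h
          obtain ⟨m, hm⟩ := hk
          omega
        have : g e₂ < g k := by
          have c3 : (k : ℝ) ≤ n := by exact_mod_cast hkn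
          have := hB' (π * k / n) (by positivity) (by rw [div_le_iff₀ n0]; gcongr) (by
            rcases hk3 with h | h
            · left; have : (k : ℝ) < e₁ := by exact_mod_cast h
              gcongr
            · right; have : (e₂ : ℝ) < k := by exact_mod_cast h
              gcongr)
          simpa [hg] using this
        exact ⟨this.le, fun _ _ => this⟩
      -- Past half a turn, k is compared with k - 2n, which has the same parity, smaller absolute
      -- value and a strictly smaller value of g.
      · have hs := g_shift (k - 2 * n)
        rw [sub_add_cancel] at hs
        have hpos : 0 < 4 * π ^ 2 * (((k - 2 * n : ℤ) : ℝ) + n) / n := by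
          have : (n : ℝ) < k := by exact_mod_cast hkn
          have : 0 < ((k - 2 * n : ℤ) : ℝ) + n := by push_cast; linarith
          positivity
        have : g e₂ ≤ g (k - 2 * n : ℤ) := by
          obtain ⟨m, hm⟩ := hk
          rcases le_total (2 * n) k with h | h
          · have := (ih (k - 2 * n) (by omega) ⟨m - n, by omega⟩).1
            rwa [show (((k - 2 * n : ℕ) : ℤ)) = k - 2 * n by omega] at this
          · have := (ih (2 * n - k) (by omega) ⟨m + n - k, by omega⟩).1
            rwa [show (((2 * n - k : ℕ) : ℤ)) = -(k - 2 * n) by omega, g_neg] at this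
        have : g e₂ < g k := by linarith
        exact ⟨this.le, fun _ _ => this⟩
  have main' : ∀ j : ℤ, Even (j + e₂) → g e₂ ≤ g j ∧ (|j| ≠ e₁ → |j| ≠ e₂ → g e₂ < g j) := by
    intro j hj
    obtain ⟨m, hm⟩ := hj
    rcases le_total 0 j with h | h
    · have := main j.toNat ⟨m, by omega⟩
      rw [show (j.toNat : ℤ) = j by omega] at this
      rwa [abs_of_nonneg h]
    · have := main (-j).toNat ⟨m - j, by omega⟩
      rw [show ((-j).toNat : ℤ) = -j by omega, g_neg] at this
      rwa [abs_of_nonpos h]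
  set x : E3 := !₂[π * M / n, -(B / 2) * cos (π * M / n), -(B / 2) * sin (π * M / n)] with hx
  have hpow : ∀ s, ptPower n x s = g (2 * s - M) - (π * M / n) ^ 2 := by
    intro s
    have x0 : x 0 = π * M / n := by simp [hx]
    have x1 : x 1 = -(B / 2) * cos (π * M / n) := by simp [hx]
    have x2 : x 2 = -(B / 2) * sin (π * M / n) := by simp [hx]
    rw [ptPower, helixPower, x0, x1, x2]
    simp only [hg]; push_cast
    rw [show π * (2 * (s : ℝ) - M) / n = 2 * π * s / n - π * M / n by ring, cos_sub]
    ring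
  have hev : ∀ s : ℤ, Even (2 * s - M + e₂) := fun s => by
    obtain ⟨m, hm⟩ := hM
    exact ⟨s + m - M, by omega⟩
  obtain ⟨m, hm⟩ := hM
  have habs : ∀ j : ℤ, |j| = e₁ ∨ |j| = e₂ → g j = g e₂ := by
    have : g e₁ = g e₂ := hB
    rintro j (h | h) <;> rcases abs_choice j with h' | h' <;> rw [h'] at h
    · rw [h, this]
    · rw [← this, ← h, g_neg]
    · rw [h]
    · rw [← h, g_neg]
  refine ⟨x, Set.ext fun s => ⟨fun hs => ?_, fun hs r => ?_⟩⟩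
  · by_contra hc
    simp only [mem_ofPred_eq, not_or] at hc
    have h3 := (main' _ (hev s)).2 hc.1 hc.2
    have h4 := hs m
    rw [hpow, hpow, show 2 * m - M = e₂ by omega] at h4
    linarith
  · rw [hpow, hpow, habs _ hs]
    linarith [(main' _ (hev r)).1]

theorem exists_nearest_eq_pair {n : ℕ} (hn : 1 ≤ n) {p q : ℤ} (hpq : p < q) (h : q - p ≤ n) :
    ∃ x, nearest n x = {p, q} := by
  -- Here e₁ has the wrong parity on purpose, so it contributes no index.
  obtain ⟨x, hx⟩ := exists_nearest_symmetric hn (M := p + q) (e₁ := q - p - 1) (e₂ := q - p)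
    (by omega) (by omega) h (by omega) ⟨q, by ring⟩
  refine ⟨x, hx.trans (Set.ext fun s => ?_)⟩
  simp only [mem_ofPred_eq, mem_insert_iff, mem_singleton_iff]
  have := abs_cases (2 * s - (p + q))
  omega

theorem exists_nearest_eq_four {n : ℕ} (hn : 1 ≤ n) {a c : ℤ} (hac : a + 2 ≤ c)
    (h : c + 1 - a ≤ n) : ∃ x, nearest n x = {a, a + 1, c, c + 1} := by
  obtain ⟨x, hx⟩ := exists_nearest_symmetric hn (M := a + c + 1) (e₁ := c - a - 1)
    (e₂ := c + 1 - a) (by omega) (by omega) h (by omega) ⟨c + 1, by ring⟩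
  refine ⟨x, hx.trans (Set.ext fun s => ?_)⟩
  simp only [mem_ofPred_eq, mem_insert_iff, mem_singleton_iff]
  have := abs_cases (2 * s - (a + c + 1))
  omega

theorem nearest_helixPt {n : ℕ} (hn : 1 ≤ n) (p : ℤ) : nearest n (helixPt n p) = {p} := by
  have hinj : ∀ s, helixPt n p = helixPt n s → s = p := fun s h => by
    have h0 := congrArg (fun v : E3 => v 0) h
    simp only [helixPt, helix] at h0
    by_contra hne
    rcases lt_or_gt_of_ne hne with h' | h' <;> have := angle_lt hn h' <;> simp at h0 this <;>
      linarith
  have hp : p ∈ nearest n (helixPt n p) := fun r => by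
    rw [← dist_helixPt_le_iff, dist_self]; exact dist_nonneg
  refine Set.ext fun s => ⟨fun hs => ?_, fun hs => by rwa [mem_singleton_iff.1 hs]⟩
  have := hs p
  rw [← dist_helixPt_le_iff, dist_self] at this
  exact hinj s (dist_le_zero.1 this)

/-- The power is affine in the centre, so at the midpoint it is the mean of two functions with a
common minimiser. A minimiser of the mean must then minimise both. -/
theorem nearest_midpoint {n : ℕ} {x y : E3} (h : (nearest n x ∩ nearest n y).Nonempty) :
    nearest n (midpoint ℝ x y) = nearest n x ∩ nearest n y := by
  have key : ∀ s, ptPower n (midpoint ℝ x y) s = (ptPower n x s + ptPower n y s) / 2 := by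
    intro s
    rw [midpoint_eq_smul_add, ptPower_eq, ptPower_eq, ptPower_eq]
    simp [helixDot]
    ring
  obtain ⟨p, hp, hp'⟩ := h
  refine Set.ext fun s => ⟨fun hs => ?_, fun hs r => ?_⟩
  · have h1 := hs p
    rw [key, key] at h1
    have h2 := hp s
    have h3 := hp' s
    exact ⟨mem_nearest_of_le hp (by linarith), mem_nearest_of_le hp' (by linarith)⟩
  · rw [key, key]
    linarith [hs.1 r, hs.2 r]

/-! ### Directions of the unbounded edges -/

/-- The direction of the unbounded edges at the two points `k` and `k + 1`. -/
noncomputable def rayDir (n : ℕ) (k : ℤ) : E3 :=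
  !₂[0, cos (π * (2 * k + 1) / n), sin (π * (2 * k + 1) / n)]

theorem helixDot_rayDir (n : ℕ) (k s : ℤ) :
    helixDot n (rayDir n k) s = cos (π * ((2 * (s - k) - 1 : ℤ) : ℝ) / n) := by
  simp only [helixDot, rayDir]
  push_cast
  rw [show π * (2 * ((s : ℝ) - k) - 1) / n = 2 * π * s / n - π * (2 * k + 1) / n by ring, cos_sub]
  simp
  ring

/-- An odd multiple of π/n stays at distance at least π/n from every multiple of 2π. Reduction
modulo 2n and evenness bring it into [π/n, π]. -/
theorem cos_odd_le {n : ℕ} (hn : 1 ≤ n) {j : ℤ} (hj : Odd j) :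
    cos (π * (j : ℝ) / n) ≤ cos (π / n) := by
  have n0 : (0 : ℝ) < n := by exact_mod_cast hn
  have π0 := pi_pos
  have main : ∀ k : ℕ, Odd k → cos (π * (k : ℝ) / n) ≤ cos (π / n) := by
    intro k
    induction k using Nat.strong_induction_on with
    | _ k ih =>
      intro hk
      obtain ⟨m, hm⟩ := hk
      rcases le_or_gt k n with hkn | hkn
      · have c : (k : ℝ) ≤ n := by exact_mod_cast hkn
        have c' : (1 : ℝ) ≤ k := by exact_mod_cast (show 1 ≤ k by omega)
        refine cos_le_cos_of_nonneg_of_le_pi (by positivity) ?_ ?_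
        · rw [div_le_iff₀ n0]; gcongr
        · gcongr; nlinarith
      · rcases le_total (2 * n) k with h | h
        · have := ih (k - 2 * n) (by omega) ⟨m - n, by omega⟩
          rwa [Nat.cast_sub h, show π * ((k : ℝ) - (2 * n : ℕ)) / n = π * k / n - 2 * π by
            push_cast; field_simp, cos_sub_two_pi] at this
        · have := ih (2 * n - k) (by omega) ⟨n - m - 1, by omega⟩
          rwa [Nat.cast_sub h, show π * (((2 * n : ℕ) : ℝ) - k) / n = 2 * π - π * k / n by
            push_cast; field_simp, cos_two_pi_sub] at this
  obtain ⟨m, hm⟩ := hj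
  rcases le_total 0 j with h | h
  · have := main j.toNat ⟨m.toNat, by omega⟩
    rwa [show ((j.toNat : ℕ) : ℝ) = (j : ℝ) by exact_mod_cast Int.toNat_of_nonneg h] at this
  · have := main (-j).toNat ⟨(-m - 1).toNat, by omega⟩
    rwa [show (((-j).toNat : ℕ) : ℝ) = ((-j : ℤ) : ℝ) by
      exact_mod_cast Int.toNat_of_nonneg (by omega : 0 ≤ -j), Int.cast_neg,
      show π * -(j : ℝ) / n = -(π * j / n) by ring, cos_neg] at this

theorem helixDot_rayDir_le {n : ℕ} (hn : 1 ≤ n) (k s : ℤ) :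
    helixDot n (rayDir n k) s ≤ cos (π / n) := by
  rw [helixDot_rayDir]
  exact cos_odd_le hn ⟨s - k - 1, by ring⟩

theorem helixDot_rayDir_self (n : ℕ) (k : ℤ) : helixDot n (rayDir n k) k = cos (π / n) := by
  rw [helixDot_rayDir, ← cos_neg]
  congr 1; push_cast; ring

theorem helixDot_rayDir_succ (n : ℕ) (k : ℤ) :
    helixDot n (rayDir n k) (k + 1) = cos (π / n) := by
  rw [helixDot_rayDir]
  congr 1; push_cast; ring

theorem helixDot_rayDir_add_period {n : ℕ} (hn : 1 ≤ n) (k s : ℤ) :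
    helixDot n (rayDir n k) (s + n) = helixDot n (rayDir n k) s := by
  rw [helixDot, helixDot, angle_add_period hn, cos_add_two_pi, sin_add_two_pi]
  simp [rayDir]

theorem rayDir_add_period {n : ℕ} (hn : 1 ≤ n) (k : ℤ) : rayDir n (k + n) = rayDir n k := by
  have n0 : (n : ℝ) ≠ 0 := by positivity
  have : π * (2 * ((k + n : ℤ) : ℝ) + 1) / n = π * (2 * k + 1) / n + 2 * π := by
    push_cast; field_simp; ring
  rw [rayDir, this, cos_add_two_pi, sin_add_two_pi, rayDir]

theorem cos_three_lt {n : ℕ} (hn : 3 ≤ n) : cos (π * 3 / n) < cos (π / n) := by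
  have n0 : (3 : ℝ) ≤ n := by exact_mod_cast hn
  have π0 := pi_pos
  refine cos_lt_cos_of_nonneg_of_le_pi (by positivity) ?_ ?_
  · rw [div_le_iff₀ (by linarith)]; gcongr
  · gcongr; linarith

theorem helixDot_rayDir_pred_lt {n : ℕ} (hn : 3 ≤ n) (k : ℤ) :
    helixDot n (rayDir n k) (k - 1) < cos (π / n) := by
  rw [helixDot_rayDir, ← cos_neg]
  convert cos_three_lt hn using 2
  push_cast; ring

theorem helixDot_rayDir_add_two_lt {n : ℕ} (hn : 3 ≤ n) (k : ℤ) :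
    helixDot n (rayDir n k) (k + 2) < cos (π / n) := by
  rw [helixDot_rayDir]
  convert cos_three_lt hn using 2
  push_cast; ring

theorem rayDir_ne_zero (n : ℕ) (k : ℤ) : rayDir n k ≠ 0 := by
  intro h
  have h1 := congrArg (fun v : E3 => v 1) h
  have h2 := congrArg (fun v : E3 => v 2) h
  simp [rayDir] at h1 h2
  have := sin_sq_add_cos_sq (π * (2 * (k : ℝ) + 1) / n)
  rw [h1, h2] at this
  norm_num at this

/-- Moving from `x` in the direction `v` keeps the nearest points that are extremal for `v`. -/
theorem nearest_add_smul {n : ℕ} {x v : E3} {m c : ℝ} (hc : 0 < c) (hv : ∀ s, helixDot n v s ≤ m)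
    {p : ℤ} (hp : p ∈ nearest n x) (hpm : helixDot n v p = m) :
    nearest n (x + c • v) = {s ∈ nearest n x | helixDot n v s = m} := by
  refine Set.ext fun s => ⟨fun hs => ?_, fun hs r => ?_⟩
  · have h1 := hs p
    rw [ptPower_add_smul, ptPower_add_smul, hpm] at h1
    have h2 := hp s
    have h3 : c * helixDot n v s ≤ c * m := by gcongr; exact hv s
    refine ⟨mem_nearest_of_le hp (by linarith), le_antisymm (hv s) ?_⟩
    exact le_of_mul_le_mul_left (by linarith) hc
  · rw [ptPower_add_smul, ptPower_add_smul, hs.2]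
    have h3 : c * helixDot n v r ≤ c * m := by gcongr; exact hv r
    linarith [hs.1 r]

theorem helixPt_injective {n : ℕ} (hn : 1 ≤ n) : Function.Injective (helixPt n) := by
  intro s r h
  have h1 := nearest_helixPt hn s
  rw [h, nearest_helixPt hn r] at h1
  exact (singleton_injective h1).symm

/-! ### Delaunay cells and affine independence -/

theorem mem_nearest_iff_dist {n : ℕ} {x : E3} {s : ℤ} :
    s ∈ nearest n x ↔ ∀ r, dist x (helixPt n s) ≤ dist x (helixPt n r) :=
  forall_congr' fun r => (dist_helixPt_le_iff n x s r).symm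

theorem isDelaunayCell_iff {n : ℕ} {T : Set E3} : IsDelaunayCell (helixSet n) T ↔
    ∃ x, (nearest n x).Nonempty ∧ T = helixPt n '' nearest n x := by
  constructor
  · rintro ⟨⟨p, hp⟩, c, r, hr, rfl⟩
    obtain ⟨⟨s, rfl⟩, hs⟩ := hp
    have key : ∀ q, q ∈ nearest n c ↔ dist (helixPt n q) c = r := by
      intro q
      rw [mem_nearest_iff_dist]
      simp only [dist_comm c]
      exact ⟨fun h => le_antisymm (hs ▸ h s) (hr _ ⟨q, rfl⟩), fun h r' => h ▸ hr _ ⟨r', rfl⟩⟩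
    refine ⟨c, ⟨s, (key s).2 hs⟩, Set.ext fun p => ⟨?_, ?_⟩⟩
    · rintro ⟨⟨q, rfl⟩, hq⟩
      exact ⟨q, (key q).2 hq, rfl⟩
    · rintro ⟨q, hq, rfl⟩
      exact ⟨⟨q, rfl⟩, (key q).1 hq⟩
  · rintro ⟨x, ⟨s, hs⟩, rfl⟩
    refine ⟨⟨_, s, hs, rfl⟩, x, dist (helixPt n s) x, ?_, Set.ext fun p => ⟨?_, ?_⟩⟩
    · rintro _ ⟨q, rfl⟩
      rw [dist_comm, dist_comm _ x]
      exact mem_nearest_iff_dist.1 hs q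
    · rintro ⟨q, hq, rfl⟩
      refine ⟨⟨q, rfl⟩, ?_⟩
      rw [dist_comm, dist_comm _ x]
      exact le_antisymm (mem_nearest_iff_dist.1 hq s) (mem_nearest_iff_dist.1 hs q)
    · rintro ⟨⟨q, rfl⟩, hq⟩
      refine ⟨q, mem_nearest_iff_dist.2 fun r => ?_, rfl⟩
      rw [dist_comm, hq, dist_comm]
      exact mem_nearest_iff_dist.1 hs r

/-- The vectors orthogonal to all differences of the points with indices in `I`. -/
noncomputable def helixOrth (n : ℕ) (I : Set ℤ) : Submodule ℝ E3 :=
  (vectorSpan ℝ (helixPt n '' I))ᗮ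

theorem mem_helixOrth {n : ℕ} {I : Set ℤ} {v : E3} :
    v ∈ helixOrth n I ↔ ∀ i ∈ I, ∀ j ∈ I, helixDot n v i = helixDot n v j := by
  constructor
  · intro h i hi j hj
    have := (Submodule.mem_orthogonal' _ _).1 h _
      (vsub_mem_vectorSpan ℝ (mem_image_of_mem _ hi) (mem_image_of_mem _ hj))
    rw [vsub_eq_sub, inner_sub_right, inner_helixPt, inner_helixPt] at this
    linarith
  · intro h
    have hle : vectorSpan ℝ (helixPt n '' I) ≤ (Submodule.span ℝ {v})ᗮ := by
      rw [vectorSpan_def, Submodule.span_le]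
      rintro _ ⟨_, ⟨i, hi, rfl⟩, _, ⟨j, hj, rfl⟩, rfl⟩
      change helixPt n i - helixPt n j ∈ (Submodule.span ℝ {v})ᗮ
      rw [Submodule.mem_orthogonal_singleton_iff_inner_right, inner_sub_right, inner_helixPt, inner_helixPt, h i hi j hj, sub_self]
    refine (Submodule.mem_orthogonal' _ _).2 fun u hu => ?_
    exact Submodule.mem_orthogonal_singleton_iff_inner_right.1 (hle hu)

/-- With angles measured from the middle μ, the scalar product with v splits into an odd part v₀u +
Q sin u and an even part P cos u, besides a constant. Constancy on ±u₁, ±u₂ makes the odd part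
vanish at u₁ and u₂, so v₀ = Q = 0 because sin u / u is strictly monotone; P = 0 because cos u₁ ≠
cos u₂. -/
theorem helixOrth_four {n : ℕ} (hn : 1 ≤ n) {a c : ℤ} (hac : a + 2 ≤ c) (h : c + 1 - a ≤ n) :
    helixOrth n {a, a + 1, c, c + 1} = ⊥ := by
  have n0 : (0 : ℝ) < n := by exact_mod_cast hn
  have π0 := pi_pos
  have k1 : (1 : ℝ) ≤ c - a - 1 := by exact_mod_cast (show 1 ≤ c - a - 1 by omega)
  have k2 : (c : ℝ) + 1 - a ≤ n := by exact_mod_cast h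
  rw [Submodule.eq_bot_iff]
  intro v hv
  rw [mem_helixOrth] at hv
  set μ := π * (a + c + 1) / n with hμ
  set u₁ := π * (c - a - 1) / n with hu1
  set u₂ := π * (c + 1 - a) / n with hu2
  have h10 : 0 < u₁ := by positivity
  have h12 : u₁ < u₂ := by rw [hu1, hu2]; gcongr ?_ / _; gcongr π * ?_; linarith
  have h2π : u₂ ≤ π := by rw [hu2, div_le_iff₀ n0]; gcongr
  have ea : 2 * π * (a : ℝ) / n = μ - u₂ := by rw [hμ, hu2]; ring
  have eb : 2 * π * ((a + 1 : ℤ) : ℝ) / n = μ - u₁ := by rw [hμ, hu1]; push_cast; ring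
  have ec : 2 * π * (c : ℝ) / n = μ + u₁ := by rw [hμ, hu1]; ring
  have ed : 2 * π * ((c + 1 : ℤ) : ℝ) / n = μ + u₂ := by rw [hμ, hu2]; push_cast; ring
  have e1 := hv a (by simp) (a + 1) (by simp)
  have e2 := hv a (by simp) c (by simp)
  have e3 := hv a (by simp) (c + 1) (by simp)
  simp only [helixDot, ea, eb, ec, ed, cos_add, sin_add, cos_sub, sin_sub] at e1 e2 e3
  set P := v 1 * cos μ + v 2 * sin μ with hP
  set Q := -(v 1) * sin μ + v 2 * cos μ with hQ
  have hcos : cos u₂ < cos u₁ := cos_lt_cos_of_nonneg_of_le_pi h10.le h2π h12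
  have hsin := mul_sin_lt_mul_sin h10 h12 h2π
  have f1 : v 0 * u₂ + Q * sin u₂ = 0 := by rw [hQ]; linear_combination (-1 / 2) * e3
  have f2 : v 0 * u₁ + Q * sin u₁ = 0 := by rw [hQ]; linear_combination (1 / 2) * e1 - (1 / 2) * e2
  have f3 : P * (cos u₂ - cos u₁) = 0 := by
    rw [hP]; linear_combination (1 / 2) * e1 + (1 / 2) * e2 - (1 / 2) * e3
  have hP0 : P = 0 := by
    rcases mul_eq_zero.1 f3 with h | h
    · exact h
    · linarith
  have hQ0 : Q = 0 := by
    have : Q * (u₂ * sin u₁ - u₁ * sin u₂) = 0 := by linear_combination u₂ * f2 - u₁ * f1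
    rcases mul_eq_zero.1 this with h | h
    · exact h
    · linarith
  have v0 : v 0 = 0 := by
    rw [hQ0, zero_mul, add_zero] at f2
    exact (mul_eq_zero.1 f2).resolve_right h10.ne'
  have hs := sin_sq_add_cos_sq μ
  have v1 : v 1 = 0 := by
    rw [hP] at hP0; rw [hQ] at hQ0
    linear_combination cos μ * hP0 - sin μ * hQ0 - v 1 * hs
  have v2 : v 2 = 0 := by
    rw [hP] at hP0; rw [hQ] at hQ0
    linear_combination sin μ * hP0 + cos μ * hQ0 - v 2 * hs
  ext i
  fin_cases i <;> simp [v0, v1, v2]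

theorem finrank_vectorSpan_add_finrank_helixOrth (n : ℕ) (I : Set ℤ) :
    Module.finrank ℝ (vectorSpan ℝ (helixPt n '' I)) + Module.finrank ℝ (helixOrth n I) = 3 := by
  rw [helixOrth, Submodule.finrank_add_finrank_orthogonal]
  simp

theorem exists_four_of_le_ncard {S : Set ℤ} (h : 4 ≤ S.ncard) :
    ∃ a ∈ S, ∃ b ∈ S, ∃ c ∈ S, ∃ d ∈ S, a < b ∧ b < c ∧ c < d := by
  obtain ⟨U, hU, hU4⟩ := Set.exists_subset_card_eq h
  have hfin : U.Finite := Set.finite_of_ncard_pos (by omega)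
  have hc : hfin.toFinset.card = 4 := by rw [← Set.ncard_eq_toFinset_card U hfin, hU4]
  set f := hfin.toFinset.orderEmbOfFin hc
  have hf : ∀ i, f i ∈ S := fun i => hU (hfin.mem_toFinset.1 (Finset.orderEmbOfFin_mem _ hc i))
  exact ⟨f 0, hf 0, f 1, hf 1, f 2, hf 2, f 3, hf 3, f.strictMono (by decide),
    f.strictMono (by decide), f.strictMono (by decide)⟩

/-- Four nearest points are the ends of two edges of the helix. -/
theorem nearest_eq_of_four_le_ncard {n : ℕ} (hn : 1 ≤ n) {x : E3} (h : 4 ≤ (nearest n x).ncard) :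
    ∃ a c : ℤ, a + 2 ≤ c ∧ c + 1 - a ≤ n ∧ nearest n x = {a, a + 1, c, c + 1} := by
  obtain ⟨a, ha, b, hb, c, hc, d, hd, hab, hbc, hcd⟩ := exists_four_of_le_ncard h
  obtain ⟨rfl, rfl, h1, h2⟩ := nearest_eq_of_four_mem hn hab hbc hcd ha hb hc hd
  exact ⟨a, c, by omega, h1, h2⟩

/-- Three distinct points of a sphere are never collinear. Four nearest points have the special form
for which the orthogonal complement was shown to vanish, and there are never more. -/
theorem affineIndependent_nearest {n : ℕ} (hn : 1 ≤ n) (x : E3) :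
    AffineIndependent ℝ (fun p : helixPt n '' nearest n x => (p : E3)) := by
  have hinj := helixPt_injective hn
  have hfin := finite_nearest hn x
  obtain h | h | h | h | h : (nearest n x).ncard = 0 ∨ (nearest n x).ncard = 1 ∨
      (nearest n x).ncard = 2 ∨ (nearest n x).ncard = 3 ∨ 4 ≤ (nearest n x).ncard := by omega
  · rw [(Set.ncard_eq_zero hfin).1 h, image_empty]
    exact affineIndependent_of_subsingleton ℝ _
  · obtain ⟨a, ha⟩ := Set.ncard_eq_one.1 h
    rw [ha, image_singleton]
    exact affineIndependent_of_subsingleton ℝ _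
  · obtain ⟨a, b, hab, e⟩ := Set.ncard_eq_two.1 h
    have := (affineIndependent_of_ne ℝ (hinj.ne hab)).range
    rwa [Matrix.range_cons, Matrix.range_cons, Matrix.range_empty, union_empty,
      singleton_union, ← image_pair, ← e] at this
  · obtain ⟨a, b, c, hab, hac, hbc, e⟩ := Set.ncard_eq_three.1 h
    have hco : EuclideanGeometry.Cospherical
        ({helixPt n a, helixPt n b, helixPt n c} : Set E3) := by
      refine ⟨x, dist x (helixPt n a), ?_⟩
      have ha : a ∈ nearest n x := by rw [e]; simp
      have key : ∀ s ∈ nearest n x, dist (helixPt n s) x = dist x (helixPt n a) := fun s hs => by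
        rw [dist_comm]
        exact le_antisymm (mem_nearest_iff_dist.1 hs a) (mem_nearest_iff_dist.1 ha s)
      rintro p (rfl | rfl | rfl) <;> exact key _ (by rw [e]; simp)
    have := (hco.affineIndependent_of_ne (hinj.ne hab) (hinj.ne hac) (hinj.ne hbc)).range
    rwa [Matrix.range_cons, Matrix.range_cons, Matrix.range_cons, Matrix.range_empty, union_empty,
      singleton_union, singleton_union, ← image_pair, ← image_insert_eq, ← e] at this
  · obtain ⟨a, c, h1, h2, e⟩ := nearest_eq_of_four_le_ncard hn h
    have hr := finrank_vectorSpan_add_finrank_helixOrth n (nearest n x)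
    rw [e, helixOrth_four hn h1 h2, finrank_bot, add_zero] at hr
    have hrange : Set.range ![helixPt n a, helixPt n (a + 1), helixPt n c, helixPt n (c + 1)]
        = helixPt n '' {a, a + 1, c, c + 1} := by
      simp only [Matrix.range_cons, Matrix.range_empty, union_empty, singleton_union,
        image_insert_eq, image_singleton]
    have := ((affineIndependent_iff_finrank_vectorSpan_eq ℝ
      ![helixPt n a, helixPt n (a + 1), helixPt n c, helixPt n (c + 1)] (n := 3)
      (by simp)).2 (by rw [hrange]; exact hr)).range
    rwa [hrange, ← e] at this

theorem finrank_helixOrth_nearest {n : ℕ} (hn : 1 ≤ n) {x : E3} (hx : (nearest n x).Nonempty) :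
    Module.finrank ℝ (helixOrth n (nearest n x)) + (nearest n x).ncard = 4 := by
  have hfin := (finite_nearest hn x).image (helixPt n)
  have : Fintype (helixPt n '' nearest n x) := hfin.fintype
  have hpos := (Set.ncard_pos (finite_nearest hn x)).2 hx
  have hcard : Fintype.card (helixPt n '' nearest n x) = (nearest n x).ncard := by
    rw [← Set.ncard_image_of_injective _ (helixPt_injective hn), ← Nat.card_coe_set_eq,
      Nat.card_eq_fintype_card]
  have h1 := (affineIndependent_nearest hn x).finrank_vectorSpan
    (n := (nearest n x).ncard - 1) (by omega)
  rw [Subtype.range_coe] at h1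
  have := finrank_vectorSpan_add_finrank_helixOrth n (nearest n x)
  omega

/-! ### Faces of the Voronoi regions -/

/-- The points having all points with indices in `J` among their nearest ones. -/
def voronoiFace (n : ℕ) (J : Set ℤ) : Set E3 := {x | J ⊆ nearest n x}

theorem helixRegion_eq (n : ℕ) (t : ℤ) : helixRegion n t = voronoiFace n {t} := by
  ext x
  simp only [helixRegion, voronoiRegion, voronoiFace, helixSet, mem_ofPred_eq, forall_mem_range,
    singleton_subset_iff, mem_nearest_iff_dist]

theorem helixFacet_eq (n : ℕ) (t k : ℤ) : helixFacet n t k = voronoiFace n {t, t + k} := by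
  rw [helixFacet, helixRegion_eq, helixRegion_eq]
  ext x
  simp [voronoiFace, insert_subset_iff]

theorem voronoiFace_union (n : ℕ) (I J : Set ℤ) :
    voronoiFace n (I ∪ J) = voronoiFace n I ∩ voronoiFace n J := by
  ext x
  simp [voronoiFace]

theorem voronoiFace_anti (n : ℕ) {I J : Set ℤ} (h : I ⊆ J) : voronoiFace n J ⊆ voronoiFace n I :=
  fun _ hx => h.trans hx

theorem mem_voronoiFace_nearest (n : ℕ) (x : E3) : x ∈ voronoiFace n (nearest n x) :=
  Subset.rfl (s := nearest n x)

/-- This lets faces be counted through their index sets. -/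
theorem nearest_eq_of_voronoiFace_eq {n : ℕ} {x y : E3}
    (h : voronoiFace n (nearest n x) = voronoiFace n (nearest n y)) :
    nearest n x = nearest n y := by
  have hx := mem_voronoiFace_nearest n x
  have hy := mem_voronoiFace_nearest n y
  rw [h] at hx
  rw [← h] at hy
  exact Subset.antisymm hy hx

theorem ptPower_combo (n : ℕ) (x y : E3) {a b : ℝ} (hab : a + b = 1) (s : ℤ) :
    ptPower n (a • x + b • y : E3) s = a * ptPower n x s + b * ptPower n y s := by
  obtain rfl : a = 1 - b := by linarith
  simp only [ptPower_eq, helixDot, PiLp.add_apply, PiLp.smul_apply, smul_eq_mul]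
  ring

theorem convex_voronoiFace (n : ℕ) (J : Set ℤ) : Convex ℝ (voronoiFace n J) := by
  intro x hx y hy a b ha hb hab j hj r
  rw [ptPower_combo n x y hab, ptPower_combo n x y hab]
  have h1 := mul_le_mul_of_nonneg_left (hx hj r) ha
  have h2 := mul_le_mul_of_nonneg_left (hy hj r) hb
  linarith

theorem sub_mem_helixOrth {n : ℕ} {I : Set ℤ} {x y : E3} (hx : x ∈ voronoiFace n I)
    (hy : y ∈ voronoiFace n I) : x - y ∈ helixOrth n I := by
  rw [mem_helixOrth]
  intro i hi j hj
  have h1 := nearest_eq (hx hi) (hx hj)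
  have h2 := nearest_eq (hy hi) (hy hj)
  rw [ptPower_eq, ptPower_eq] at h1 h2
  have : ∀ s, helixDot n (x - y) s = helixDot n x s - helixDot n y s := fun s => by
    have := helixDot_add_smul n x y (-1) s
    rw [neg_one_smul, ← sub_eq_add_neg] at this
    rw [this]; ring
  rw [this, this]
  linarith

/-- Ties among nearest sites persist exactly in the direction v. Strict inequalities survive small
moves, uniformly because only sites within one turn need checking. -/
theorem eventually_nearest_subset {n : ℕ} (hn : 1 ≤ n) {x v : E3} (hx : (nearest n x).Nonempty)
    (hv : v ∈ helixOrth n (nearest n x)) :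
    ∀ᶠ c : ℝ in nhds 0, nearest n x ⊆ nearest n (x + c • v) := by
  obtain ⟨p, hp⟩ := hx
  rw [mem_helixOrth] at hv
  have heq : ∀ c : ℝ, ∀ s ∈ nearest n x, ptPower n (x + c • v) s = ptPower n (x + c • v) p := by
    intro c s hs
    rw [ptPower_add_smul, ptPower_add_smul, nearest_eq hs hp, hv s hs p hp]
  have h : ∀ s, ∀ᶠ c : ℝ in nhds 0, ptPower n (x + c • v) p ≤ ptPower n (x + c • v) s := by
    intro s
    by_cases hs : s ∈ nearest n x
    · exact Filter.Eventually.of_forall fun c => (heq c s hs).ge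
    · have hlt := lt_of_notMem_nearest hp hs
      have hc : ∀ q, Continuous fun c : ℝ => ptPower n (x + c • v) q := fun q => by
        simp only [ptPower_add_smul]; fun_prop
      have := ((hc p).tendsto 0).eventually_lt ((hc s).tendsto 0) (by simpa using hlt)
      exact this.mono fun c h => h.le
  have hall := (Filter.eventually_all_finset (Finset.Icc (p - n) (p + n))).2 fun s _ => h s
  filter_upwards [hall] with c hc s hs
  have : p ∈ nearest n (x + c • v) := mem_nearest_of_near hn fun s hs => hc s (by
    rw [Finset.mem_Icc]; rw [abs_le] at hs; omega)
  exact mem_nearest_of_le this (heq c s hs).le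

theorem exists_nearest_subset {n : ℕ} (hn : 1 ≤ n) {x v : E3} (hx : (nearest n x).Nonempty)
    (hv : v ∈ helixOrth n (nearest n x)) :
    ∃ c : ℝ, 0 < c ∧ nearest n x ⊆ nearest n (x + c • v) ∧
      nearest n x ⊆ nearest n (x + (-c) • v) := by
  have h1 := eventually_nearest_subset hn hx hv
  have h2 : ∀ᶠ c : ℝ in nhds 0, nearest n x ⊆ nearest n (x + (-c) • v) :=
    (continuous_neg.tendsto' (0 : ℝ) 0 neg_zero).eventually h1
  obtain ⟨ε, hε, h⟩ := Metric.eventually_nhds_iff.1 (h1.and h2)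
  refine ⟨ε / 2, by positivity, h ?_⟩
  rw [dist_zero_right, Real.norm_eq_abs, abs_of_pos (by positivity)]
  linarith

theorem vectorSpan_voronoiFace {n : ℕ} (hn : 1 ≤ n) {x : E3} (hx : (nearest n x).Nonempty) :
    vectorSpan ℝ (voronoiFace n (nearest n x)) = helixOrth n (nearest n x) := by
  apply le_antisymm
  · rw [vectorSpan_def, Submodule.span_le]
    rintro _ ⟨y, hy, z, hz, rfl⟩
    exact sub_mem_helixOrth hy hz
  · intro v hv
    obtain ⟨c, hc, h, -⟩ := exists_nearest_subset hn hx hv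
    have := vsub_mem_vectorSpan ℝ (s := voronoiFace n (nearest n x)) h
      (mem_voronoiFace_nearest n x)
    rw [vsub_eq_sub, add_sub_cancel_left] at this
    simpa [smul_smul, inv_mul_cancel₀ hc.ne'] using Submodule.smul_mem _ c⁻¹ this

theorem affDim_voronoiFace {n : ℕ} (hn : 1 ≤ n) {x : E3} (hx : (nearest n x).Nonempty) :
    affDim (voronoiFace n (nearest n x)) + (nearest n x).ncard = 4 := by
  rw [affDim, vectorSpan_voronoiFace hn hx, finrank_helixOrth_nearest hn hx]

theorem affDim_empty : affDim (∅ : Set E3) = 0 := by simp [affDim]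

/-- The exposing functional is the sum of the outer normals h(i) - h(p) over nearest i. Its deficit
at y is half a sum of nonnegative power differences, zero only if every i is nearest to y. -/
theorem isExposed_voronoiFace {n : ℕ} (hn : 1 ≤ n) {J : Set ℤ} (hJ : J.Nonempty) {x : E3}
    (hx : J ⊆ nearest n x) : IsExposed ℝ (voronoiFace n J) (voronoiFace n (nearest n x)) := by
  intro _
  obtain ⟨p, hpJ⟩ := hJ
  have hp := hx hpJ
  set F := (finite_nearest hn x).toFinset with hF
  have hmem : ∀ i, i ∈ F ↔ i ∈ nearest n x := fun i => (finite_nearest hn x).mem_toFinset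
  refine ⟨∑ i ∈ F, innerSL ℝ (helixPt n i - helixPt n p), ?_⟩
  set l : StrongDual ℝ E3 := ∑ i ∈ F, innerSL ℝ (helixPt n i - helixPt n p) with hl
  have hval : ∀ y, l y = ∑ i ∈ F, (helixDot n y i - helixDot n y p) := fun y => by
    rw [hl, sum_apply]
    refine Finset.sum_congr rfl fun i _ => ?_
    rw [innerSL_apply_apply, real_inner_comm, inner_sub_right, inner_helixPt, inner_helixPt]
  have hdiff : ∀ y, l x - l y = (1 / 2) * ∑ i ∈ F, (ptPower n y i - ptPower n y p) := fun y => by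
    rw [hval, hval, ← Finset.sum_sub_distrib, Finset.mul_sum]
    refine Finset.sum_congr rfl fun i hi => ?_
    have := nearest_eq ((hmem i).1 hi) hp
    rw [ptPower_eq, ptPower_eq] at this
    rw [ptPower_eq, ptPower_eq]
    linarith
  have hle : ∀ y ∈ voronoiFace n J, l y ≤ l x := fun y hy => by
    have : 0 ≤ ∑ i ∈ F, (ptPower n y i - ptPower n y p) :=
      Finset.sum_nonneg fun i _ => sub_nonneg.2 (hy hpJ i)
    linarith [hdiff y]
  refine Set.ext fun y => ⟨fun hy => ⟨voronoiFace_anti n hx hy, fun z hz => ?_⟩, ?_⟩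
  · refine (hle z hz).trans ?_
    have : ∑ i ∈ F, (ptPower n y i - ptPower n y p) = 0 := Finset.sum_eq_zero fun i hi => by
      rw [nearest_eq (hy ((hmem i).1 hi)) (hy hp), sub_self]
    have := hdiff y
    rw [‹∑ i ∈ F, (ptPower n y i - ptPower n y p) = 0›] at this
    linarith
  · rintro ⟨hy, hmax⟩ i hi
    have h0 : ∑ i ∈ F, (ptPower n y i - ptPower n y p) ≤ 0 := by
      linarith [hdiff y, hmax x hx]
    have h1 := (Finset.sum_eq_zero_iff_of_nonneg fun i _ => sub_nonneg.2 (hy hpJ i)).1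
      (le_antisymm h0 (Finset.sum_nonneg fun i _ => sub_nonneg.2 (hy hpJ i))) i ((hmem i).2 hi)
    exact mem_nearest_of_le (hy hpJ) (sub_nonpos.1 h1.le)

/-- A point x of B with the fewest nearest sites is relatively interior. For y in B, the midpoint of
x and y shows that every site nearest to x is nearest to y. Conversely, from x one can move both
ways along the line to any y of the face of x, so the exposing functional is constant there. -/
theorem exists_eq_voronoiFace_of_isExposed {n : ℕ} (hn : 1 ≤ n) {J : Set ℤ} (hJ : J.Nonempty)
    {B : Set E3} (hB : B.Nonempty) (h : IsExposed ℝ (voronoiFace n J) B) :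
    ∃ x, J ⊆ nearest n x ∧ B = voronoiFace n (nearest n x) := by
  have hconv := h.convex (convex_voronoiFace n J)
  have hsub : B ⊆ voronoiFace n J := h.subset
  obtain ⟨x, hx, hmin⟩ : ∃ x ∈ B, ∀ y ∈ B, (nearest n x).ncard ≤ (nearest n y).ncard := by
    classical
    have hex : ∃ m, ∃ x ∈ B, (nearest n x).ncard = m := ⟨_, hB.some, hB.some_mem, rfl⟩
    obtain ⟨x, hx, hm⟩ := Nat.find_spec hex
    exact ⟨x, hx, fun y hy => hm ▸ Nat.find_min' hex ⟨y, hy, rfl⟩⟩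
  have hxJ : J ⊆ nearest n x := hsub hx
  have hne : (nearest n x).Nonempty := hJ.mono hxJ
  refine ⟨x, hxJ, Subset.antisymm (fun y hy => ?_) fun y hy => ?_⟩
  · have hm := nearest_midpoint (n := n) (x := x) (y := y) (hJ.mono (subset_inter hxJ (hsub hy)))
    have h1 := hmin _ (hconv.midpoint_mem hx hy)
    rw [hm] at h1
    have := Set.eq_of_subset_of_ncard_le inter_subset_left h1 (finite_nearest hn x)
    exact inter_eq_left.1 this
  · have hv := sub_mem_helixOrth hy (mem_voronoiFace_nearest n x)
    obtain ⟨c, hc, h1, h2⟩ := exists_nearest_subset hn hne hv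
    obtain ⟨l, hl⟩ := h hB
    have hyJ : y ∈ voronoiFace n J := voronoiFace_anti n hxJ hy
    rw [hl] at hx ⊢
    have g1 := hx.2 _ (hxJ.trans h1)
    have g2 := hx.2 _ (hxJ.trans h2)
    have g3 : l y - l x = 0 := by
      rw [map_add, map_smul, map_sub, smul_eq_mul] at g1 g2
      have : c * (l y - l x) = 0 := by linarith
      exact (mul_eq_zero.1 this).resolve_left hc.ne'
    exact ⟨hyJ, fun z hz => by linarith [hx.2 z hz]⟩

theorem isFace_voronoiFace_iff {n : ℕ} (hn : 1 ≤ n) {J : Set ℤ} (hJ : J.Nonempty) {B : Set E3}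
    {k : ℕ} : IsFace (voronoiFace n J) B k ↔
      ∃ x, J ⊆ nearest n x ∧ B = voronoiFace n (nearest n x) ∧ k + (nearest n x).ncard = 4 := by
  constructor
  · rintro ⟨hB, hexp, hk⟩
    obtain ⟨x, hx, rfl⟩ := exists_eq_voronoiFace_of_isExposed hn hJ hB hexp
    exact ⟨x, hx, rfl, hk ▸ affDim_voronoiFace hn (hJ.mono hx)⟩
  · rintro ⟨x, hx, rfl, hk⟩
    refine ⟨⟨x, mem_voronoiFace_nearest n x⟩, isExposed_voronoiFace hn hJ hx, ?_⟩
    have := affDim_voronoiFace hn (hJ.mono hx)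
    omega

/-! ### Edges as segments and rays -/

/-- An edge of the Voronoi diagram with two distinct ends. -/
theorem voronoiFace_eq_segment {n : ℕ} (hn : 1 ≤ n) {x y : E3} {i j : ℤ}
    (h3 : (nearest n x ∩ nearest n y).ncard = 3) (hi : i ∈ nearest n x) (hi' : i ∉ nearest n y)
    (hj : j ∈ nearest n y) (hj' : j ∉ nearest n x) :
    voronoiFace n (nearest n x ∩ nearest n y) = segment ℝ x y := by
  have hne : (nearest n x ∩ nearest n y).Nonempty := Set.nonempty_of_ncard_ne_zero (by omega)
  have hfr := finrank_helixOrth_nearest hn (x := midpoint ℝ x y)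
    (by rwa [nearest_midpoint hne])
  rw [nearest_midpoint hne, h3] at hfr
  have hfr1 : Module.finrank ℝ (helixOrth n (nearest n x ∩ nearest n y)) = 1 := by omega
  have hx : x ∈ voronoiFace n (nearest n x ∩ nearest n y) := inter_subset_left
  have hy : y ∈ voronoiFace n (nearest n x ∩ nearest n y) := inter_subset_right
  have hxy : (⟨y - x, sub_mem_helixOrth hy hx⟩ : helixOrth n (nearest n x ∩ nearest n y)) ≠ 0 := by
    intro h
    rw [Submodule.mk_eq_zero, sub_eq_zero] at h
    exact hi' (h ▸ hi)
  refine Subset.antisymm (fun z hz => ?_) ((convex_voronoiFace n _).segment_subset hx hy)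
  obtain ⟨c, hc⟩ := (finrank_eq_one_iff_of_nonzero' _ hxy).1 hfr1
    ⟨z - x, sub_mem_helixOrth hz hx⟩
  have hc' : c • (y - x) = z - x := congrArg Subtype.val hc
  have hz' : z = (1 - c) • x + c • y := by
    rw [eq_sub_iff_add_eq] at hc'
    rw [← hc']
    module
  obtain ⟨p, hp⟩ := hne
  have key : ∀ s, ptPower n z s = (1 - c) * ptPower n x s + c * ptPower n y s := fun s => by
    rw [hz', ptPower_combo n x y (by ring)]
  -- Comparing p with i, which is nearest to x only, forces 0 ≤ c; comparing it with j forces c ≤ 1.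
  have h1 := hz hp i
  have h2 := hz hp j
  rw [key, key] at h1 h2
  have e1 := nearest_eq hi hp.1
  have e2 := nearest_eq hj hp.2
  have l1 := lt_of_notMem_nearest hp.2 hi'
  have l2 := lt_of_notMem_nearest hp.1 hj'
  have c0 : 0 ≤ c := by
    rw [e1] at h1
    by_contra! hneg
    nlinarith
  have c1 : 0 ≤ 1 - c := by
    rw [e2] at h2
    by_contra! hneg
    nlinarith
  exact ⟨1 - c, c, c1, c0, by ring, hz'.symm⟩

/-- An unbounded edge of the Voronoi diagram. -/
theorem voronoiFace_eq_rayFrom {n : ℕ} (hn : 1 ≤ n) {x v : E3} {m : ℝ}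
    (hv : ∀ s, helixDot n v s ≤ m) (h3 : {s ∈ nearest n x | helixDot n v s = m}.ncard = 3) {i : ℤ}
    (hi : i ∈ nearest n x) (hi' : helixDot n v i ≠ m) :
    voronoiFace n {s ∈ nearest n x | helixDot n v s = m} = rayFrom x v := by
  obtain ⟨p, hp, hpm⟩ : {s ∈ nearest n x | helixDot n v s = m}.Nonempty :=
    Set.nonempty_of_ncard_ne_zero (by omega)
  have hadd : ∀ c : ℝ, 0 < c → nearest n (x + c • v) = {s ∈ nearest n x | helixDot n v s = m} :=
    fun c hc => nearest_add_smul hc hv hp hpm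
  have hfr := finrank_helixOrth_nearest hn (x := x + (1 : ℝ) • v)
    (by rw [hadd 1 one_pos]; exact ⟨p, hp, hpm⟩)
  rw [hadd 1 one_pos, h3] at hfr
  have hfr1 : Module.finrank ℝ (helixOrth n {s ∈ nearest n x | helixDot n v s = m}) = 1 := by
    omega
  have hx : x ∈ voronoiFace n {s ∈ nearest n x | helixDot n v s = m} := fun s hs => hs.1
  have hv' : v ∈ helixOrth n {s ∈ nearest n x | helixDot n v s = m} :=
    mem_helixOrth.2 fun a ha b hb => ha.2.trans hb.2.symm
  have hv0 : (⟨v, hv'⟩ : helixOrth n {s ∈ nearest n x | helixDot n v s = m}) ≠ 0 := by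
    intro h
    rw [Submodule.mk_eq_zero] at h
    refine hi' (Eq.trans ?_ hpm)
    simp [h, helixDot]
  refine Set.ext fun z => ⟨fun hz => ?_, ?_⟩
  · obtain ⟨c, hc⟩ := (finrank_eq_one_iff_of_nonzero' _ hv0).1 hfr1
      ⟨z - x, sub_mem_helixOrth hz hx⟩
    have hc' : c • v = z - x := congrArg Subtype.val hc
    have hz' : z = x + c • v := by rw [hc']; abel
    refine ⟨c, ?_, hz'⟩
    have h1 := hz (show p ∈ {s ∈ nearest n x | helixDot n v s = m} from ⟨hp, hpm⟩) i
    rw [hz', ptPower_add_smul, ptPower_add_smul, nearest_eq hi hp, hpm] at h1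
    have hlt := lt_of_le_of_ne (hv i) hi'
    by_contra! hneg
    nlinarith
  · rintro ⟨c, hc, rfl⟩
    rcases hc.eq_or_lt with rfl | hc
    · simpa using hx
    · exact (hadd c hc).ge

/-- The combinatorial condition for three points of the helix to span a Delaunay triangle. -/
def IsHelixTriple (n : ℕ) (i j k : ℤ) : Prop :=
  (i ≠ j ∧ i ≠ k ∧ j ≠ k) ∧
  (i - j ≤ n ∧ j - i ≤ n ∧ i - k ≤ n ∧ k - i ≤ n ∧ j - k ≤ n ∧ k - j ≤ n) ∧
  (i = j + 1 ∨ j = i + 1 ∨ i = k + 1 ∨ k = i + 1 ∨ j = k + 1 ∨ k = j + 1)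

/-- Two of three points of the helix differ by exactly one turn. -/
def SpansTurn (n : ℕ) (i j k : ℤ) : Prop :=
  i = j + n ∨ j = i + n ∨ i = k + n ∨ k = i + n ∨ j = k + n ∨ k = j + n

/-- The third index of an edge may lie anywhere relative to the two of its facet; this reduces
symmetric claims to sorted triples. -/
theorem triple_induction {C : ℤ → ℤ → ℤ → Prop} (h12 : ∀ i j k, C i j k → C j i k)
    (h23 : ∀ i j k, C i j k → C i k j) (hs : ∀ p q r, p < q → q < r → C p q r) {i j k : ℤ}
    (hij : i ≠ j) (hik : i ≠ k) (hjk : j ≠ k) : C i j k := by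
  rcases lt_or_gt_of_ne hij with h1 | h1 <;> rcases lt_or_gt_of_ne hik with h2 | h2 <;>
    rcases lt_or_gt_of_ne hjk with h3 | h3
  · exact hs _ _ _ h1 h3
  · exact h23 _ _ _ (hs _ _ _ h2 h3)
  · omega
  · exact h23 _ _ _ (h12 _ _ _ (hs _ _ _ h2 h1))
  · exact h12 _ _ _ (hs _ _ _ h1 h2)
  · omega
  · exact h12 _ _ _ (h23 _ _ _ (hs _ _ _ h3 h2))
  · exact h12 _ _ _ (h23 _ _ _ (h12 _ _ _ (hs _ _ _ h3 h1)))

theorem triple_comm₁₂ (i j k : ℤ) : ({j, i, k} : Set ℤ) = {i, j, k} := insert_comm _ _ _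

theorem triple_comm₂₃ (i j k : ℤ) : ({i, k, j} : Set ℤ) = {i, j, k} := by rw [pair_comm]

theorem isHelixTriple_of_mem_nearest {n : ℕ} (hn : 1 ≤ n) {x : E3} {i j k : ℤ} (hij : i ≠ j)
    (hik : i ≠ k) (hjk : j ≠ k) (hi : i ∈ nearest n x) (hj : j ∈ nearest n x)
    (hk : k ∈ nearest n x) : IsHelixTriple n i j k := by
  refine triple_induction (C := fun i j k => i ∈ nearest n x → j ∈ nearest n x → k ∈ nearest n x →
    IsHelixTriple n i j k) ?_ ?_ ?_ hij hik hjk hi hj hk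
  · intro i j k h hj hi hk
    have := h hi hj hk
    unfold IsHelixTriple at *
    omega
  · intro i j k h hi hk hj
    have := h hi hj hk
    unfold IsHelixTriple at *
    omega
  · intro p q r hpq hqr hp hq hr
    have h1 := consecutive_of_mem_nearest hn hpq hqr hp hq hr
    have h2 := sub_le_of_mem_nearest hn hp hr
    unfold IsHelixTriple
    omega

theorem exists_ends_of_sorted {n : ℕ} (hn : 1 ≤ n) {p q r : ℤ} (hpq : p < q) (hqr : q < r)
    (h : q = p + 1 ∨ r = q + 1) (hr : r - p < n) : ∃ x y i j,
      nearest n x ∩ nearest n y = {p, q, r} ∧ i ∈ nearest n x ∧ i ∉ nearest n y ∧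
        j ∈ nearest n y ∧ j ∉ nearest n x := by
  suffices ∃ a c b d : ℤ, (a + 2 ≤ c ∧ c + 1 - a ≤ n) ∧ (b + 2 ≤ d ∧ d + 1 - b ≤ n) ∧
      (({a, a + 1, c, c + 1} : Set ℤ) ∩ {b, b + 1, d, d + 1} = {p, q, r}) ∧
      (∃ i ∈ ({a, a + 1, c, c + 1} : Set ℤ), i ∉ ({b, b + 1, d, d + 1} : Set ℤ)) ∧
      (∃ j ∈ ({b, b + 1, d, d + 1} : Set ℤ), j ∉ ({a, a + 1, c, c + 1} : Set ℤ)) by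
    obtain ⟨a, c, b, d, h1, h2, h3, ⟨i, hi, hi'⟩, ⟨j, hj, hj'⟩⟩ := this
    obtain ⟨x, hx⟩ := exists_nearest_eq_four hn h1.1 h1.2
    obtain ⟨y, hy⟩ := exists_nearest_eq_four hn h2.1 h2.2
    exact ⟨x, y, i, j, by rw [hx, hy, h3], by rwa [hx], by rwa [hy], by rwa [hy], by rwa [hx]⟩
  -- The two ends adjoin a neighbour of the lone index on either side; three consecutive indices are
  -- prolonged at either end. Both quadruples fit into one turn because r - p < n.
  by_cases hq : q = p + 1
  · by_cases hr2 : r = q + 1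
    · refine ⟨p - 1, p + 1, p, p + 2, ⟨by omega, by omega⟩, ⟨by omega, by omega⟩, ?_,
        ⟨p - 1, ?_, ?_⟩, ⟨p + 3, ?_, ?_⟩⟩
      · ext s; simp only [mem_inter_iff, mem_insert_iff, mem_singleton_iff]; omega
      all_goals simp only [mem_insert_iff, mem_singleton_iff, true_or] <;> omega
    · refine ⟨p, r - 1, p, r, ⟨by omega, by omega⟩, ⟨by omega, by omega⟩, ?_,
        ⟨r - 1, ?_, ?_⟩, ⟨r + 1, ?_, ?_⟩⟩
      · ext s; simp only [mem_inter_iff, mem_insert_iff, mem_singleton_iff]; omega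
      all_goals simp only [mem_insert_iff, mem_singleton_iff, true_or, or_true] <;> omega
  · refine ⟨p, q, p - 1, q, ⟨by omega, by omega⟩, ⟨by omega, by omega⟩, ?_,
      ⟨p + 1, ?_, ?_⟩, ⟨p - 1, ?_, ?_⟩⟩
    · ext s; simp only [mem_inter_iff, mem_insert_iff, mem_singleton_iff]; omega
    all_goals simp only [mem_insert_iff, mem_singleton_iff, true_or, or_true] <;> omega

theorem ncard_triple {i j k : ℤ} (hij : i ≠ j) (hik : i ≠ k) (hjk : j ≠ k) :
    ({i, j, k} : Set ℤ).ncard = 3 := Set.ncard_eq_three.2 ⟨i, j, k, hij, hik, hjk, rfl⟩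

/-- Both rays start at the vertex with nearest set i, i+1, i+n-1, i+n. The direction `rayDir n i`
has equal, maximal products with i, i+1 and i+n, so moving along it keeps these and drops i+n-1;
`rayDir n (i - 1)` drops i+1 instead. -/
theorem exists_ray {n : ℕ} (hn : 3 ≤ n) (i : ℤ) : ∃ z : E3,
    (voronoiFace n {i, i + 1, i + n} = rayFrom z (rayDir n i) ∧
      voronoiFace n {i, i + n - 1, i + n} = rayFrom z (rayDir n (i - 1))) ∧
    (∃ x, nearest n x = {i, i + 1, i + n}) ∧ ∃ x, nearest n x = {i, i + n - 1, i + n} := by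
  have hn1 : 1 ≤ n := by omega
  obtain ⟨z, hz⟩ := exists_nearest_eq_four hn1 (a := i) (c := i + n - 1) (by omega) (by omega)
  have hmem : ∀ s, s ∈ nearest n z ↔ s = i ∨ s = i + 1 ∨ s = i + n - 1 ∨ s = i + n := fun s => by
    rw [hz]; simp
  have e1 : {s ∈ nearest n z | helixDot n (rayDir n i) s = cos (π / n)} = {i, i + 1, i + n} := by
    have a1 := helixDot_rayDir_self n i
    have a2 := helixDot_rayDir_succ n i
    have a3 := helixDot_rayDir_add_period hn1 i i
    have a4 := helixDot_rayDir_add_period hn1 i (i - 1)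
    have a5 := helixDot_rayDir_pred_lt hn i
    rw [show i - 1 + (n : ℤ) = i + n - 1 by ring] at a4
    ext s
    simp only [mem_ofPred_eq, hmem, mem_insert_iff, mem_singleton_iff]
    constructor
    · rintro ⟨rfl | rfl | rfl | rfl, h⟩
      · simp
      · simp
      · linarith
      · simp
    · rintro (rfl | rfl | rfl)
      · exact ⟨Or.inl rfl, a1⟩
      · exact ⟨Or.inr (Or.inl rfl), a2⟩
      · exact ⟨Or.inr (Or.inr (Or.inr rfl)), a3.trans a1⟩
  have e2 : {s ∈ nearest n z | helixDot n (rayDir n (i - 1)) s = cos (π / n)}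
      = {i, i + n - 1, i + n} := by
    have a1 := helixDot_rayDir_self n (i - 1)
    have a2 := helixDot_rayDir_succ n (i - 1)
    have a3 := helixDot_rayDir_add_period hn1 (i - 1) i
    have a4 := helixDot_rayDir_add_period hn1 (i - 1) (i - 1)
    have a5 := helixDot_rayDir_add_two_lt hn (i - 1)
    rw [show i - 1 + (n : ℤ) = i + n - 1 by ring] at a4
    rw [sub_add_cancel] at a2
    rw [show i - 1 + 2 = i + 1 by ring] at a5
    ext s
    simp only [mem_ofPred_eq, hmem, mem_insert_iff, mem_singleton_iff]
    constructor
    · rintro ⟨rfl | rfl | rfl | rfl, h⟩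
      · simp
      · linarith
      · simp
      · simp
    · rintro (rfl | rfl | rfl)
      · exact ⟨Or.inl rfl, a2⟩
      · exact ⟨Or.inr (Or.inr (Or.inl rfl)), a4.trans a1⟩
      · exact ⟨Or.inr (Or.inr (Or.inr rfl)), a3.trans a2⟩
  have hle := helixDot_rayDir_le hn1
  have hi1 : helixDot n (rayDir n i) (i + n - 1) ≠ cos (π / n) := fun h => by
    have := e1.subset (show i + (n : ℤ) - 1 ∈ {s ∈ nearest n z | _} from ⟨(hmem _).2 (by omega), h⟩)
    simp only [mem_insert_iff, mem_singleton_iff] at this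
    omega
  have hi2 : helixDot n (rayDir n (i - 1)) (i + 1) ≠ cos (π / n) := fun h => by
    have := e2.subset (show i + 1 ∈ {s ∈ nearest n z | _} from ⟨(hmem _).2 (by omega), h⟩)
    simp only [mem_insert_iff, mem_singleton_iff] at this
    omega
  refine ⟨z, ⟨?_, ?_⟩, ⟨z + (1 : ℝ) • rayDir n i, ?_⟩, ⟨z + (1 : ℝ) • rayDir n (i - 1), ?_⟩⟩
  · rw [← e1]
    refine voronoiFace_eq_rayFrom hn1 (hle i) ?_ ((hmem _).2 (by omega)) hi1
    rw [e1]
    exact ncard_triple (by omega) (by omega) (by omega)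
  · rw [← e2]
    refine voronoiFace_eq_rayFrom hn1 (hle (i - 1)) ?_ ((hmem _).2 (by omega)) hi2
    rw [e2]
    exact ncard_triple (by omega) (by omega) (by omega)
  · rw [nearest_add_smul one_pos (hle i) ((hmem i).2 (by omega)) (helixDot_rayDir_self n i), e1]
  · have := helixDot_rayDir_succ n (i - 1)
    rw [sub_add_cancel] at this
    rw [nearest_add_smul one_pos (hle (i - 1)) ((hmem i).2 (by omega)) this, e2]

theorem exists_nearest_eq_triple {n : ℕ} (hn : 3 ≤ n) {i j k : ℤ} (h : IsHelixTriple n i j k) :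
    ∃ x, nearest n x = {i, j, k} := by
  refine triple_induction (C := fun i j k => IsHelixTriple n i j k → ∃ x, nearest n x = {i, j, k})
    ?_ ?_ ?_ h.1.1 h.1.2.1 h.1.2.2 h
  · intro i j k h h'
    rw [triple_comm₁₂]
    exact h (by unfold IsHelixTriple at *; omega)
  · intro i j k h h'
    rw [triple_comm₂₃]
    exact h (by unfold IsHelixTriple at *; omega)
  · intro p q r hpq hqr h
    unfold IsHelixTriple at h
    by_cases hr : r - p < n
    · obtain ⟨x, y, i, j, he, -⟩ := exists_ends_of_sorted (by omega) hpq hqr (by omega) hr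
      exact ⟨midpoint ℝ x y, by rw [nearest_midpoint (by rw [he]; simp), he]⟩
    · obtain ⟨z, -, h1, h2⟩ := exists_ray hn p
      obtain rfl : r = p + n := by omega
      by_cases hq : q = p + 1
      · rwa [hq]
      · rwa [show q = p + n - 1 by omega]

theorem isSegment_voronoiFace {n : ℕ} (hn : 1 ≤ n) {i j k : ℤ} (h : IsHelixTriple n i j k)
    (hs : ¬ SpansTurn n i j k) : IsSegment (voronoiFace n {i, j, k}) := by
  refine triple_induction (C := fun i j k => IsHelixTriple n i j k → ¬ SpansTurn n i j k →
    IsSegment (voronoiFace n {i, j, k})) ?_ ?_ ?_ h.1.1 h.1.2.1 h.1.2.2 h hs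
  · intro i j k h h1 h2
    rw [triple_comm₁₂]
    exact h (by unfold IsHelixTriple at *; omega) (by unfold SpansTurn at *; omega)
  · intro i j k h h1 h2
    rw [triple_comm₂₃]
    exact h (by unfold IsHelixTriple at *; omega) (by unfold SpansTurn at *; omega)
  · intro p q r hpq hqr h1 h2
    unfold IsHelixTriple at h1
    unfold SpansTurn at h2
    obtain ⟨x, y, i, j, he, hi, hi', hj, hj'⟩ :=
      exists_ends_of_sorted hn hpq hqr (by omega) (by omega)
    refine ⟨x, y, fun hxy => hi' (hxy ▸ hi), ?_⟩
    rw [← he]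
    refine voronoiFace_eq_segment hn ?_ hi hi' hj hj'
    rw [he]
    exact ncard_triple (by omega) (by omega) (by omega)

theorem isRay_voronoiFace {n : ℕ} (hn : 3 ≤ n) {i j k : ℤ} (h : IsHelixTriple n i j k)
    (hs : SpansTurn n i j k) : IsRay (voronoiFace n {i, j, k}) := by
  refine triple_induction (C := fun i j k => IsHelixTriple n i j k → SpansTurn n i j k →
    IsRay (voronoiFace n {i, j, k})) ?_ ?_ ?_ h.1.1 h.1.2.1 h.1.2.2 h hs
  · intro i j k h h1 h2
    rw [triple_comm₁₂]
    exact h (by unfold IsHelixTriple at *; omega) (by unfold SpansTurn at *; omega)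
  · intro i j k h h1 h2
    rw [triple_comm₂₃]
    exact h (by unfold IsHelixTriple at *; omega) (by unfold SpansTurn at *; omega)
  · intro p q r hpq hqr h1 h2
    unfold IsHelixTriple at h1
    unfold SpansTurn at h2
    obtain ⟨z, ⟨e1, e2⟩, -⟩ := exists_ray hn p
    obtain rfl : r = p + n := by omega
    by_cases hq : q = p + 1
    · exact ⟨z, _, rayDir_ne_zero n p, by rw [hq, e1]⟩
    · exact ⟨z, _, rayDir_ne_zero n (p - 1), by rw [show q = p + n - 1 by omega, e2]⟩

theorem not_isRay_of_isSegment {e : Set E3} (h : IsSegment e) : ¬ IsRay e := by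
  rintro ⟨p, v, hv, he⟩
  obtain ⟨a, b, -, rfl⟩ := h
  have hb : Bornology.IsBounded (segment ℝ a b) := by
    rw [← convexHull_pair]
    exact isBounded_convexHull.2 (Set.toFinite _).isBounded
  obtain ⟨R, hR⟩ := hb.exists_norm_le
  have hv' : 0 < ‖v‖ := norm_pos_iff.2 hv
  have hp : ‖p‖ ≤ R := hR p (by rw [he]; exact ⟨0, le_rfl, by simp⟩)
  have hR0 : 0 ≤ R := (norm_nonneg p).trans hp
  have hs : 0 ≤ (R + ‖p‖ + 1) / ‖v‖ := by positivity
  have h1 := hR (p + ((R + ‖p‖ + 1) / ‖v‖) • v) (by rw [he]; exact ⟨_, hs, rfl⟩)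
  have h2 := norm_sub_norm_le (((R + ‖p‖ + 1) / ‖v‖) • v) (-p)
  rw [norm_neg, norm_smul, Real.norm_of_nonneg hs, div_mul_cancel₀ _ hv'.ne', sub_neg_eq_add,
    add_comm _ p] at h2
  linarith

theorem isHelixTriple_add (n : ℕ) (t i j k : ℤ) :
    IsHelixTriple n (t + i) (t + j) (t + k) ↔ IsHelixTriple n i j k := by
  unfold IsHelixTriple; omega

theorem spansTurn_add (n : ℕ) (t i j k : ℤ) :
    SpansTurn n (t + i) (t + j) (t + k) ↔ SpansTurn n i j k := by
  unfold SpansTurn; omega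

theorem isHelixTriple_shift {n : ℕ} (t : ℤ) {k r : ℤ} (h : IsHelixTriple n 0 k r) :
    IsHelixTriple n t (t + k) (t + r) := by
  have := (isHelixTriple_add n t 0 k r).2 h
  rwa [add_zero] at this

theorem spansTurn_shift (n : ℕ) (t k r : ℤ) : SpansTurn n t (t + k) (t + r) ↔ SpansTurn n 0 k r := by
  have := spansTurn_add n t 0 k r
  rwa [add_zero] at this

/-! ### Counting the edges of the facets -/

/-- Edges come from nearest sets of size three containing t and t + k, so they are indexed by the
third element, taken relative to t. -/
theorem edges_helixFacet {n : ℕ} (hn : 3 ≤ n) (t : ℤ) {k : ℤ} (hk : k ≠ 0) :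
    edges (helixFacet n t k) =
      (fun r => voronoiFace n {t, t + k, t + r}) '' {r | IsHelixTriple n 0 k r} := by
  have hn1 : 1 ≤ n := by omega
  ext e
  simp only [edges, helixFacet_eq, mem_ofPred_eq]
  rw [isFace_voronoiFace_iff hn1 (insert_nonempty _ _)]
  constructor
  · rintro ⟨x, hx, rfl, hc⟩
    rw [insert_subset_iff, singleton_subset_iff] at hx
    obtain ⟨m, hm, hmt⟩ : ∃ m ∈ nearest n x, m ∉ ({t, t + k} : Set ℤ) := by
      refine Set.exists_mem_notMem_of_ncard_lt_ncard ?_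
      rw [Set.ncard_pair (by omega)]
      omega
    simp only [mem_insert_iff, mem_singleton_iff, not_or] at hmt
    have htr := isHelixTriple_of_mem_nearest hn1 (by omega) (Ne.symm hmt.1) (Ne.symm hmt.2)
      hx.1 hx.2 hm
    refine ⟨m - t, ?_, ?_⟩
    · have := isHelixTriple_add n (-t) t (t + k) m
      rw [neg_add_cancel, neg_add_cancel_left, neg_add_eq_sub] at this
      exact this.2 htr
    · simp only [add_sub_cancel]
      congr 1
      refine Set.eq_of_subset_of_ncard_le ?_ ?_ (finite_nearest hn1 x)
      · rintro s (rfl | rfl | rfl)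
        exacts [hx.1, hx.2, hm]
      · rw [ncard_triple htr.1.1 htr.1.2.1 htr.1.2.2]
        omega
  · rintro ⟨r, hr, rfl⟩
    have htr := isHelixTriple_shift t hr
    obtain ⟨x, hx⟩ := exists_nearest_eq_triple hn htr
    refine ⟨x, ?_, by rw [hx], by rw [hx, ncard_triple htr.1.1 htr.1.2.1 htr.1.2.2]⟩
    rw [hx]
    rintro s (rfl | rfl) <;> simp

theorem injOn_voronoiFace_triple {n : ℕ} (hn : 3 ≤ n) (t k : ℤ) :
    InjOn (fun r => voronoiFace n {t, t + k, t + r}) {r | IsHelixTriple n 0 k r} := by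
  intro r hr r' hr' h
  have h1 := isHelixTriple_shift t hr
  obtain ⟨x, hx⟩ := exists_nearest_eq_triple hn h1
  obtain ⟨y, hy⟩ := exists_nearest_eq_triple hn (isHelixTriple_shift t hr')
  simp only [← hx, ← hy] at h
  have h2 := nearest_eq_of_voronoiFace_eq h
  have : t + r ∈ nearest n y := by rw [← h2, hx]; simp
  rw [hy] at this
  simp only [mem_insert_iff, mem_singleton_iff] at this
  have := h1.1
  omega

theorem boundedBy_helixFacet {n : ℕ} (hn : 3 ≤ n) (t : ℤ) {k : ℤ} (hk : k ≠ 0) {a b : ℕ}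
    (ha : {r | IsHelixTriple n 0 k r ∧ ¬ SpansTurn n 0 k r}.encard = a)
    (hb : {r | IsHelixTriple n 0 k r ∧ SpansTurn n 0 k r}.encard = b) :
    BoundedBy (helixFacet n t k) a b := by
  have hseg : ∀ r, IsHelixTriple n 0 k r → ¬ SpansTurn n 0 k r →
      IsSegment (voronoiFace n {t, t + k, t + r}) := fun r h1 h2 =>
    isSegment_voronoiFace (by omega) (isHelixTriple_shift t h1) (by rwa [spansTurn_shift])
  have hray : ∀ r, IsHelixTriple n 0 k r → SpansTurn n 0 k r →
      IsRay (voronoiFace n {t, t + k, t + r}) := fun r h1 h2 =>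
    isRay_voronoiFace hn (isHelixTriple_shift t h1) (by rwa [spansTurn_shift])
  refine ⟨?_, ?_, ?_⟩
  · rw [edges_helixFacet hn t hk]
    rintro _ ⟨r, hr, rfl⟩
    by_cases hs : SpansTurn n 0 k r
    · exact Or.inr (hray r hr hs)
    · exact Or.inl (hseg r hr hs)
  · rw [← ha, ← ((injOn_voronoiFace_triple hn t k).mono fun r hr => hr.1).encard_image]
    congr 1
    ext e
    rw [edges_helixFacet hn t hk]
    constructor
    · rintro ⟨⟨r, hr, rfl⟩, he⟩
      exact ⟨r, ⟨hr, fun hs => not_isRay_of_isSegment he (hray r hr hs)⟩, rfl⟩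
    · rintro ⟨r, ⟨hr, hs⟩, rfl⟩
      exact ⟨⟨r, hr, rfl⟩, hseg r hr hs⟩
  · rw [← hb, ← ((injOn_voronoiFace_triple hn t k).mono fun r hr => hr.1).encard_image]
    congr 1
    ext e
    rw [edges_helixFacet hn t hk]
    constructor
    · rintro ⟨⟨r, hr, rfl⟩, he⟩
      refine ⟨r, ⟨hr, ?_⟩, rfl⟩
      by_contra hs
      exact not_isRay_of_isSegment (hseg r hr hs) he
    · rintro ⟨r, ⟨hr, hs⟩, rfl⟩
      exact ⟨⟨r, hr, rfl⟩, hray r hr hs⟩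

theorem encard_neg_triple (P : ℤ → ℤ → Prop) (hP : ∀ k r, P k r → P (-k) (-r)) (k : ℤ) :
    {r | P (-k) r}.encard = {r | P k r}.encard := by
  rw [← (neg_injective (G := ℤ)).encard_image {r | P k r}]
  congr 1
  ext r
  constructor
  · intro h
    exact ⟨-r, by simpa using hP _ _ h, neg_neg r⟩
  · rintro ⟨s, hs, rfl⟩
    exact hP _ _ hs

theorem boundedBy_helixFacet_of_abs {n : ℕ} (hn : 3 ≤ n) (t : ℤ) {k : ℤ} (hk : k ≠ 0) {a b : ℕ}
    (ha : {r | IsHelixTriple n 0 |k| r ∧ ¬ SpansTurn n 0 |k| r}.encard = a)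
    (hb : {r | IsHelixTriple n 0 |k| r ∧ SpansTurn n 0 |k| r}.encard = b) :
    BoundedBy (helixFacet n t k) a b := by
  rcases abs_choice k with h | h <;> rw [h] at ha hb
  · exact boundedBy_helixFacet hn t hk ha hb
  · rw [encard_neg_triple (fun k r => IsHelixTriple n 0 k r ∧ ¬ SpansTurn n 0 k r)] at ha
    · rw [encard_neg_triple (fun k r => IsHelixTriple n 0 k r ∧ SpansTurn n 0 k r)] at hb
      · exact boundedBy_helixFacet hn t hk ha hb
      · intro k r; unfold IsHelixTriple SpansTurn; omega
    · intro k r; unfold IsHelixTriple SpansTurn; omega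

theorem boundedBy_one {n : ℕ} (hn : 4 ≤ n) (t : ℤ) {k : ℤ} (hk : |k| = 1) :
    BoundedBy (helixFacet n t k) (2 * n - 4) 2 := by
  refine boundedBy_helixFacet_of_abs (by omega) t (by rintro rfl; simp at hk) ?_ ?_ <;> rw [hk]
  -- Since 0 and 1 are already consecutive, r only has to stay within a turn of both; the extreme
  -- values 1 - n and n give the rays.
  · have : {r | IsHelixTriple n 0 1 r ∧ ¬ SpansTurn n 0 1 r}
        = (((Finset.Icc (2 - n : ℤ) (n - 1)).erase 0).erase 1 : Finset ℤ) := by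
      ext r
      simp only [mem_ofPred_eq, Finset.mem_coe, Finset.mem_erase, Finset.mem_Icc, IsHelixTriple,
        SpansTurn]
      omega
    rw [this, Set.encard_coe_eq_coe_finsetCard, Finset.card_erase_of_mem, Finset.card_erase_of_mem,
      Int.card_Icc]
    · congr 1; omega
    · rw [Finset.mem_Icc]; omega
    · rw [Finset.mem_erase, Finset.mem_Icc]; omega
  · have : {r | IsHelixTriple n 0 1 r ∧ SpansTurn n 0 1 r} = {1 - (n : ℤ), (n : ℤ)} := by
      ext r
      simp only [mem_ofPred_eq, mem_insert_iff, mem_singleton_iff, IsHelixTriple, SpansTurn]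
      omega
    rw [this, Set.encard_pair (by omega)]; rfl

theorem boundedBy_two {n : ℕ} (hn : 4 ≤ n) (t : ℤ) {k : ℤ} (hk : |k| = 2) :
    BoundedBy (helixFacet n t k) 3 0 := by
  refine boundedBy_helixFacet_of_abs (by omega) t (by rintro rfl; simp at hk) ?_ ?_ <;> rw [hk]
  -- Edges come from the neighbours of 0 and of k. For k = 2 the inner neighbours coincide, which
  -- leaves a triangle.
  · have : {r | IsHelixTriple n 0 2 r ∧ ¬ SpansTurn n 0 2 r} = {-1, 1, 3} := by
      ext r
      simp only [mem_ofPred_eq, mem_insert_iff, mem_singleton_iff, IsHelixTriple, SpansTurn]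
      omega
    rw [this, Set.encard_eq_three.2 ⟨-1, 1, 3, by omega, by omega, by omega, rfl⟩]; rfl
  · have : {r | IsHelixTriple n 0 2 r ∧ SpansTurn n 0 2 r} = ∅ := by
      ext r
      simp only [mem_ofPred_eq, mem_empty_iff_false, iff_false, IsHelixTriple, SpansTurn]
      omega
    rw [this, Set.encard_empty]; rfl

theorem boundedBy_middle {n : ℕ} (t : ℤ) {k : ℤ} (h3 : 3 ≤ |k|) (hkn : |k| ≤ (n : ℤ) - 2) :
    BoundedBy (helixFacet n t k) 4 0 := by
  refine boundedBy_helixFacet_of_abs (by omega) t (by rintro rfl; simp at h3) ?_ ?_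
  · have : {r | IsHelixTriple n 0 |k| r ∧ ¬ SpansTurn n 0 |k| r}
        = (({-1, 1, |k| - 1, |k| + 1} : Finset ℤ) : Set ℤ) := by
      ext r
      simp only [mem_ofPred_eq, Finset.mem_coe, Finset.mem_insert, Finset.mem_singleton,
        IsHelixTriple, SpansTurn]
      generalize |k| = m at *
      omega
    rw [this, Set.encard_coe_eq_coe_finsetCard, Finset.card_insert_of_notMem,
      Finset.card_insert_of_notMem, Finset.card_pair (by omega)] <;>
    · simp only [Finset.mem_insert, Finset.mem_singleton]; omega
  · have : {r | IsHelixTriple n 0 |k| r ∧ SpansTurn n 0 |k| r} = ∅ := by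
      ext r
      simp only [mem_ofPred_eq, mem_empty_iff_false, iff_false, IsHelixTriple, SpansTurn]
      generalize |k| = m at *
      omega
    rw [this, Set.encard_empty]; rfl

theorem boundedBy_sub_one {n : ℕ} (hn : 4 ≤ n) (t : ℤ) {k : ℤ} (hk : |k| = (n : ℤ) - 1) :
    BoundedBy (helixFacet n t k) 2 2 := by
  refine boundedBy_helixFacet_of_abs (by omega) t (by rintro rfl; simp at hk; omega) ?_ ?_ <;>
    rw [hk]
  · have : {r | IsHelixTriple n 0 (n - 1) r ∧ ¬ SpansTurn n 0 (n - 1) r} = {1, (n : ℤ) - 2} := by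
      ext r
      simp only [mem_ofPred_eq, mem_insert_iff, mem_singleton_iff, IsHelixTriple, SpansTurn]
      omega
    rw [this, Set.encard_pair (by omega)]; rfl
  · have : {r | IsHelixTriple n 0 (n - 1) r ∧ SpansTurn n 0 (n - 1) r} = {-1, (n : ℤ)} := by
      ext r
      simp only [mem_ofPred_eq, mem_insert_iff, mem_singleton_iff, IsHelixTriple, SpansTurn]
      omega
    rw [this, Set.encard_pair (by omega)]; rfl

theorem boundedBy_turn {n : ℕ} (hn : 4 ≤ n) (t : ℤ) {k : ℤ} (hk : |k| = (n : ℤ)) :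
    BoundedBy (helixFacet n t k) 0 2 := by
  refine boundedBy_helixFacet_of_abs (by omega) t (by rintro rfl; simp at hk; omega) ?_ ?_ <;>
    rw [hk]
  · have : {r | IsHelixTriple n 0 n r ∧ ¬ SpansTurn n 0 n r} = ∅ := by
      ext r
      simp only [mem_ofPred_eq, mem_empty_iff_false, iff_false, IsHelixTriple, SpansTurn]
      omega
    rw [this, Set.encard_empty]; rfl
  · have : {r | IsHelixTriple n 0 n r ∧ SpansTurn n 0 n r} = {1, (n : ℤ) - 1} := by
      ext r
      simp only [mem_ofPred_eq, mem_insert_iff, mem_singleton_iff, IsHelixTriple, SpansTurn]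
      omega
    rw [this, Set.encard_pair (by omega)]; rfl

/-! ### Parallel rays and adjacency -/

/-- Both rays of a facet next to two consecutive turns have the direction given by `m`. -/
theorem parallelRays_helixFacet {n : ℕ} (hn : 3 ≤ n) (t : ℤ) {k : ℤ} (hk : k ≠ 0) (m : ℤ)
    (h : ∀ r, IsHelixTriple n 0 k r → SpansTurn n 0 k r → ∃ i : ℤ, rayDir n i = rayDir n m ∧
      (({t, t + k, t + r} : Set ℤ) = {i, i + 1, i + n} ∨
        ({t, t + k, t + r} : Set ℤ) = {i + 1, i + n, i + n + 1})) :
    ParallelRays (helixFacet n t k) := by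
  refine ⟨rayDir n m, rayDir_ne_zero n m, fun e he hray => ?_⟩
  rw [edges_helixFacet hn t hk] at he
  obtain ⟨r, hr, rfl⟩ := he
  by_cases hs : SpansTurn n 0 k r
  · obtain ⟨i, him, hi | hi⟩ := h r hr hs
    · obtain ⟨z, ⟨hz, -⟩, -⟩ := exists_ray hn i
      exact ⟨z, by beta_reduce; rw [hi, hz, him]⟩
    · obtain ⟨z, ⟨-, hz⟩, -⟩ := exists_ray hn (i + 1)
      rw [add_sub_cancel_right, show i + 1 + (n : ℤ) - 1 = i + n by ring,
        show i + 1 + (n : ℤ) = i + n + 1 by ring] at hz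
      exact ⟨z, by beta_reduce; rw [hi, hz, him]⟩
  · exact (not_isRay_of_isSegment (isSegment_voronoiFace (by omega) (isHelixTriple_shift t hr)
      (by rwa [spansTurn_shift])) hray).elim

theorem parallelRays_one {n : ℕ} (hn : 4 ≤ n) (t : ℤ) {k : ℤ} (hk : |k| = 1) :
    ParallelRays (helixFacet n t k) := by
  have hper := rayDir_add_period (n := n) (by omega)
  rcases (abs_eq one_pos.le).1 hk with rfl | rfl
  · refine parallelRays_helixFacet (by omega) t (by omega) t fun r h1 h2 => ?_
    obtain rfl | rfl : r = n ∨ r = 1 - n := by unfold IsHelixTriple SpansTurn at *; omega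
    · exact ⟨t, rfl, Or.inl rfl⟩
    · refine ⟨t - n, by rw [← hper (t - n), sub_add_cancel], Or.inr ?_⟩
      ext s; simp only [mem_insert_iff, mem_singleton_iff]; omega
  · refine parallelRays_helixFacet (by omega) t (by omega) (t - 1) fun r h1 h2 => ?_
    obtain rfl | rfl : r = -n ∨ r = n - 1 := by unfold IsHelixTriple SpansTurn at *; omega
    · refine ⟨t - 1 - n, by rw [← hper (t - 1 - n), sub_add_cancel], Or.inr ?_⟩
      ext s; simp only [mem_insert_iff, mem_singleton_iff]; omega
    · refine ⟨t - 1, rfl, Or.inl ?_⟩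
      ext s; simp only [mem_insert_iff, mem_singleton_iff]; omega

/-- Modulo a turn, t and t ± (n - 1) are consecutive, and both rays take the direction belonging to
that pair. -/
theorem parallelRays_sub_one {n : ℕ} (hn : 4 ≤ n) (t : ℤ) {k : ℤ} (hk : |k| = (n : ℤ) - 1) :
    ParallelRays (helixFacet n t k) := by
  have hper := rayDir_add_period (n := n) (by omega)
  rcases (abs_eq (by omega)).1 hk with rfl | rfl
  · refine parallelRays_helixFacet (by omega) t (by omega) (t - 1) fun r h1 h2 => ?_
    obtain rfl | rfl : r = n ∨ r = -1 := by unfold IsHelixTriple SpansTurn at *; omega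
    · refine ⟨t - 1, rfl, Or.inr ?_⟩
      ext s; simp only [mem_insert_iff, mem_singleton_iff]; omega
    · refine ⟨t - 1, rfl, Or.inl ?_⟩
      ext s; simp only [mem_insert_iff, mem_singleton_iff]; omega
  · refine parallelRays_helixFacet (by omega) t (by omega) t fun r h1 h2 => ?_
    obtain rfl | rfl : r = -n ∨ r = 1 := by unfold IsHelixTriple SpansTurn at *; omega
    · refine ⟨t - n, by rw [← hper (t - n), sub_add_cancel], Or.inl ?_⟩
      ext s; simp only [mem_insert_iff, mem_singleton_iff]; omega
    · refine ⟨t - n, by rw [← hper (t - n), sub_add_cancel], Or.inr ?_⟩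
      ext s; simp only [mem_insert_iff, mem_singleton_iff]; omega

theorem adjacentFacets_iff {n : ℕ} (hn : 3 ≤ n) (t : ℤ) {i j : ℤ} (hi : i ≠ 0) (hj : j ≠ 0)
    (hij : i ≠ j) :
    AdjacentFacets (helixFacet n t i) (helixFacet n t j) ↔ IsHelixTriple n 0 i j := by
  have hset : helixFacet n t i ∩ helixFacet n t j = voronoiFace n {t, t + i, t + j} := by
    rw [helixFacet_eq, helixFacet_eq, ← voronoiFace_union]
    congr 1
    ext s; simp only [mem_union, mem_insert_iff, mem_singleton_iff]; tauto
  rw [AdjacentFacets, hset]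
  constructor
  · intro h
    -- The empty set has `affDim` 0, so dimension one provides a point.
    obtain ⟨x, hx⟩ : (voronoiFace n {t, t + i, t + j}).Nonempty := by
      rw [nonempty_iff_ne_empty]
      intro he
      rw [he, affDim_empty] at h
      exact zero_ne_one h
    have := isHelixTriple_of_mem_nearest (by omega) (i := t) (j := t + i) (k := t + j) (by omega)
      (by omega) (by omega) (hx (by simp)) (hx (by simp)) (hx (by simp))
    have h0 := isHelixTriple_add n t 0 i j
    rw [add_zero] at h0
    exact h0.1 this
  · intro h
    have htr := isHelixTriple_shift t h
    obtain ⟨x, hx⟩ := exists_nearest_eq_triple hn htr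
    have := affDim_voronoiFace (n := n) (by omega) (x := x) (by rw [hx]; simp)
    rw [hx, ncard_triple htr.1.1 htr.1.2.1 htr.1.2.2] at this
    omega

/-! ### The region as a polyhedron, its facets and its symmetry -/

theorem isPolyhedron_helixRegion {n : ℕ} (hn : 1 ≤ n) (t : ℤ) :
    IsPolyhedron (helixRegion n t) := by
  classical
  refine ⟨((Finset.Icc (-n : ℤ) n).erase 0).image fun k => (helixPt n (t + k) - helixPt n t,
    ((2 * π * ((t + k : ℤ) : ℝ) / n) ^ 2 - (2 * π * (t : ℝ) / n) ^ 2) / 2), ?_, ?_⟩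
  · intro p hp
    obtain ⟨k, hk, rfl⟩ := Finset.mem_image.1 hp
    rw [Finset.mem_erase] at hk
    exact sub_ne_zero.2 fun h => hk.1 (by have := helixPt_injective hn h; omega)
  · have key : ∀ x : E3, ∀ k : ℤ, inner ℝ (helixPt n (t + k) - helixPt n t) x ≤
        ((2 * π * ((t + k : ℤ) : ℝ) / n) ^ 2 - (2 * π * (t : ℝ) / n) ^ 2) / 2 ↔
        ptPower n x t ≤ ptPower n x (t + k) := fun x k => by
      rw [real_inner_comm, inner_sub_right, inner_helixPt, inner_helixPt, ptPower_eq, ptPower_eq]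
      constructor <;> intro h <;> linarith
    ext x
    simp only [helixRegion_eq, voronoiFace, mem_ofPred_eq, singleton_subset_iff,
      Finset.forall_mem_image, key]
    refine ⟨fun h k _ => h _, fun h => mem_nearest_of_near hn fun s hs => ?_⟩
    by_cases hst : s = t
    · rw [hst]
    · rw [abs_le] at hs
      have := h (x := s - t) (by rw [Finset.mem_erase, Finset.mem_Icc]; omega)
      rwa [add_sub_cancel] at this

theorem affDim_helixRegion {n : ℕ} (hn : 1 ≤ n) (t : ℤ) : affDim (helixRegion n t) = 3 := by
  have h := affDim_voronoiFace hn (x := helixPt n t) (by rw [nearest_helixPt hn]; simp)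
  rw [nearest_helixPt hn, Set.ncard_singleton] at h
  rw [helixRegion_eq]
  omega

theorem exists_nearest_eq_pair_shift {n : ℕ} (hn : 1 ≤ n) (t : ℤ) {k : ℤ} (hk : 1 ≤ |k|)
    (hkn : |k| ≤ (n : ℤ)) : ∃ x, nearest n x = {t, t + k} := by
  rcases le_abs.1 hk with h | h <;> rw [abs_le] at hkn
  · exact exists_nearest_eq_pair hn (by omega) (by omega)
  · rw [pair_comm]
    exact exists_nearest_eq_pair hn (by omega) (by omega)

theorem facets_helixRegion {n : ℕ} (hn : 1 ≤ n) (t : ℤ) :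
    facets (helixRegion n t) = helixFacet n t '' {k : ℤ | 1 ≤ |k| ∧ |k| ≤ (n : ℤ)} := by
  ext B
  simp only [facets, helixRegion_eq, mem_ofPred_eq]
  rw [isFace_voronoiFace_iff hn (singleton_nonempty t)]
  constructor
  · rintro ⟨x, hx, rfl, hc⟩
    rw [singleton_subset_iff] at hx
    obtain ⟨m, hm⟩ : ∃ m, nearest n x = {t, m} ∧ t ≠ m := by
      obtain ⟨a, b, hab, e⟩ := Set.ncard_eq_two.1 (show (nearest n x).ncard = 2 by omega)
      rw [e] at hx
      rcases hx with rfl | rfl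
      · exact ⟨b, e, hab⟩
      · exact ⟨a, e.trans (pair_comm _ _), hab.symm⟩
    have hmx : m ∈ nearest n x := by rw [hm.1]; simp
    have h1 := sub_le_of_mem_nearest hn hx hmx
    have h2 := sub_le_of_mem_nearest hn hmx hx
    refine ⟨m - t, ⟨Int.one_le_abs (by have := hm.2; omega), abs_le.2 ⟨by omega, by omega⟩⟩, ?_⟩
    rw [helixFacet_eq, add_sub_cancel, hm.1]
  · rintro ⟨k, ⟨hk, hkn⟩, rfl⟩
    obtain ⟨x, hx⟩ := exists_nearest_eq_pair_shift hn t hk hkn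
    have hk0 : k ≠ 0 := by rintro rfl; simp at hk
    exact ⟨x, by rw [hx]; simp, by rw [helixFacet_eq, hx],
      by rw [hx, Set.ncard_pair (by omega)]⟩

theorem injOn_helixFacet {n : ℕ} (hn : 1 ≤ n) (t : ℤ) :
    InjOn (helixFacet n t) {k : ℤ | 1 ≤ |k| ∧ |k| ≤ (n : ℤ)} := by
  rintro k ⟨hk, hkn⟩ r ⟨hr, hrn⟩ h
  obtain ⟨x, hx⟩ := exists_nearest_eq_pair_shift hn t hk hkn
  obtain ⟨y, hy⟩ := exists_nearest_eq_pair_shift hn t hr hrn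
  rw [helixFacet_eq, helixFacet_eq, ← hx, ← hy] at h
  have : t + k ∈ nearest n y := by rw [← nearest_eq_of_voronoiFace_eq h, hx]; simp
  rw [hy] at this
  have hk0 : k ≠ 0 := by rintro rfl; simp at hk
  rcases this with h | h
  · omega
  · rw [mem_singleton_iff] at h; omega

theorem encard_facets_helixRegion {n : ℕ} (hn : 1 ≤ n) (t : ℤ) :
    (facets (helixRegion n t)).encard = 2 * n := by
  rw [facets_helixRegion hn, (injOn_helixFacet hn t).encard_image]
  have : {k : ℤ | 1 ≤ |k| ∧ |k| ≤ (n : ℤ)} = ((Finset.Icc (-n : ℤ) n).erase 0 : Finset ℤ) := by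
    ext k
    simp only [mem_ofPred_eq, Finset.mem_coe, Finset.mem_erase, Finset.mem_Icc, abs_le]
    refine and_congr_left fun _ => ⟨?_, Int.one_le_abs⟩
    rintro h rfl
    simp at h
  rw [this, Set.encard_coe_eq_coe_finsetCard, Finset.card_erase_of_mem, Int.card_Icc,
    show ((n : ℤ) + 1 - -n).toNat - 1 = 2 * n by omega]
  · push_cast; rfl
  · rw [Finset.mem_Icc]; omega

/-- The half-turn reversing the helix at its `t`-th point. -/
theorem exists_halfTurn (n : ℕ) (t : ℤ) :
    ∃ σ : E3 ≃ᵃⁱ[ℝ] E3, (∀ x, σ (σ x) = x) ∧ ∀ k, σ (helixPt n (t + k)) = helixPt n (t - k) := by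
  set τ := 2 * π * (t : ℝ) / n with hτ
  set p : E3 := !₂[τ, 0, 0] with hp
  set u : E3 := !₂[0, cos τ, sin τ] with hu
  set s : AffineSubspace ℝ E3 := AffineSubspace.mk' p (Submodule.span ℝ {u}) with hs
  have : Nonempty s := ⟨p, AffineSubspace.self_mem_mk' _ _⟩
  refine ⟨EuclideanGeometry.reflection s, EuclideanGeometry.reflection_reflection s, fun k => ?_⟩
  set κ := 2 * π * (k : ℝ) / n with hκ
  set w : E3 := !₂[κ, -(sin τ * sin κ), cos τ * sin κ] with hw
  -- The site is split into a point of the axis, even in κ, and a vector w orthogonal to the axis,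
  -- odd in κ; the reflection negates w.
  have e1 : helixPt n (t + k) = w +ᵥ (cos κ • u +ᵥ p) := by
    have : 2 * π * ((t + k : ℤ) : ℝ) / n = τ + κ := by rw [hτ, hκ]; push_cast; ring
    rw [helixPt, helix, this, cos_add, sin_add]
    ext i
    fin_cases i <;> simp [hw, hu, hp] <;> ring
  have e2 : helixPt n (t - k) = -w +ᵥ (cos κ • u +ᵥ p) := by
    have : 2 * π * ((t - k : ℤ) : ℝ) / n = τ - κ := by rw [hτ, hκ]; push_cast; ring
    rw [helixPt, helix, this, cos_sub, sin_sub]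
    ext i
    fin_cases i <;> simp [hw, hu, hp] <;> ring
  rw [e1, e2]
  refine EuclideanGeometry.reflection_orthogonal_vadd ?_ ?_
  · exact AffineSubspace.vadd_mem_mk' _
      (Submodule.smul_mem _ _ (Submodule.mem_span_singleton_self u))
  · rw [hs, AffineSubspace.direction_mk', Submodule.mem_orthogonal_singleton_iff_inner_right,
      PiLp.inner_apply, Fin.sum_univ_three]
    simp [hw, hu]
    ring

theorem image_helixRegion_of_reverse {n : ℕ} {t : ℤ} {σ : E3 ≃ᵃⁱ[ℝ] E3} (hσ : ∀ x, σ (σ x) = x)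
    (h : ∀ k, σ (helixPt n (t + k)) = helixPt n (t - k)) (k : ℤ) :
    σ '' helixRegion n (t + k) = helixRegion n (t - k) := by
  have key : ∀ k, ∀ x ∈ helixRegion n (t + k), σ x ∈ helixRegion n (t - k) := by
    intro k x hx
    rw [helixRegion_eq, voronoiFace, mem_ofPred_eq, singleton_subset_iff,
      mem_nearest_iff_dist] at hx ⊢
    have hd : ∀ r, dist (σ x) (helixPt n (t - r)) = dist x (helixPt n (t + r)) := fun r => by
      rw [← h, σ.dist_map]
    intro r
    have := hd (t - r)
    rw [sub_sub_cancel] at this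
    rw [hd, this]
    exact hx _
  refine Subset.antisymm (image_subset_iff.2 (key k)) fun x hx => ⟨σ x, ?_, hσ x⟩
  have := key (-k) x (by rwa [← sub_eq_add_neg])
  rwa [sub_neg_eq_add] at this

theorem exists_symmetry (n : ℕ) (t : ℤ) :
    ∃ σ : E3 ≃ᵃⁱ[ℝ] E3, (∀ x, σ (σ x) = x) ∧ σ '' helixRegion n t = helixRegion n t ∧
      ∀ k : ℤ, σ '' helixFacet n t k = helixFacet n t (-k) := by
  obtain ⟨σ, hσ, h⟩ := exists_halfTurn n t
  have h0 := image_helixRegion_of_reverse hσ h 0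
  rw [add_zero, sub_zero] at h0
  refine ⟨σ, hσ, h0, fun k => ?_⟩
  rw [helixFacet, helixFacet, image_inter σ.injective, h0, image_helixRegion_of_reverse hσ h,
    sub_eq_add_neg]

/-- Sites one turn apart differ by (2π, 0, 0), so both planes are orthogonal to the axis of the
helix. -/
theorem helixOrth_turn {n : ℕ} (hn : 1 ≤ n) (t : ℤ) :
    helixOrth n {t, t + (n : ℤ)} = helixOrth n {t, t + -(n : ℤ)} := by
  have key : ∀ (v : E3) (s : ℤ), helixDot n v (s + n) = helixDot n v s + 2 * π * v 0 := by
    intro v s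
    rw [helixDot, helixDot, angle_add_period hn, cos_add_two_pi, sin_add_two_pi]
    ring
  have hpair : ∀ (v : E3) (a b : ℤ), v ∈ helixOrth n {a, b} ↔ helixDot n v a = helixDot n v b := by
    intro v a b
    rw [mem_helixOrth]
    refine ⟨fun h => h a (by simp) b (by simp), fun h => ?_⟩
    rintro i (rfl | rfl) j (rfl | rfl)
    exacts [rfl, h, h.symm, rfl]
  ext v
  have h1 := key v t
  have h2 := key v (t + -(n : ℤ))
  rw [neg_add_cancel_right] at h2
  rw [hpair, hpair]
  constructor <;> intro h <;> linarith

theorem parallel_affineSpan_turn {n : ℕ} (hn : 1 ≤ n) (t : ℤ) :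
    (affineSpan ℝ (helixFacet n t (n : ℤ))).Parallel
      (affineSpan ℝ (helixFacet n t (-(n : ℤ)))) := by
  have habs : |(n : ℤ)| = n := abs_of_nonneg (by positivity)
  obtain ⟨x, hx⟩ := exists_nearest_eq_pair_shift hn t (k := n) (by omega) habs.le
  obtain ⟨y, hy⟩ := exists_nearest_eq_pair_shift hn t (k := -n) (by rw [abs_neg]; omega)
    (by rw [abs_neg]; exact habs.le)
  have hx' := mem_voronoiFace_nearest n x
  have hy' := mem_voronoiFace_nearest n y
  rw [helixFacet_eq, helixFacet_eq, ← hx, ← hy,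
    AffineSubspace.parallel_iff_direction_eq_and_eq_bot_iff_eq_bot, direction_affineSpan,
    direction_affineSpan, vectorSpan_voronoiFace hn (by rw [hx]; simp),
    vectorSpan_voronoiFace hn (by rw [hy]; simp), affineSpan_eq_bot, affineSpan_eq_bot, hx, hy]
  rw [hx] at hx'
  rw [hy] at hy'
  exact ⟨helixOrth_turn hn t, fun h => (notMem_empty _ (h ▸ hx')).elim,
    fun h => (notMem_empty _ (h ▸ hy')).elim⟩

/-- A vertex has nearest set a, a+1, c, c+1, in which t is accompanied by t + 1 or t - 1. -/
theorem mem_helixFacet_one_of_vertex {n : ℕ} (hn : 1 ≤ n) (t : ℤ) {x : E3}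
    (hx : IsFace (helixRegion n t) {x} 0) : x ∈ helixFacet n t 1 ∨ x ∈ helixFacet n t (-1) := by
  rw [helixRegion_eq, isFace_voronoiFace_iff hn (singleton_nonempty t)] at hx
  obtain ⟨y, hy, he, hc⟩ := hx
  have hxy : x = y := by
    have := mem_voronoiFace_nearest n y
    rw [← he] at this
    exact this.symm
  subst hxy
  rw [singleton_subset_iff] at hy
  obtain ⟨a, c, -, -, e⟩ := nearest_eq_of_four_le_ncard hn (x := x) (by omega)
  simp only [helixFacet_eq, voronoiFace, mem_ofPred_eq, e, insert_subset_iff,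
    singleton_subset_iff, mem_insert_iff, mem_singleton_iff]
  rw [e] at hy
  simp only [mem_insert_iff, mem_singleton_iff] at hy
  omega

theorem isDelaunaySimplex_four_iff {n : ℕ} (hn : 1 ≤ n) {a b c d : ℤ} (hab : a < b) (hbc : b < c)
    (hcd : c < d) :
    IsDelaunaySimplex (helixSet n) {helixPt n a, helixPt n b, helixPt n c, helixPt n d} ↔
      b - a = 1 ∧ d - c = 1 ∧ d - a ≤ (n : ℤ) := by
  have himg : ({helixPt n a, helixPt n b, helixPt n c, helixPt n d} : Set E3)
      = helixPt n '' {a, b, c, d} := by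
    simp only [image_insert_eq, image_singleton]
  rw [IsDelaunaySimplex, isDelaunayCell_iff, himg]
  constructor
  · rintro ⟨⟨x, -, hx⟩, -⟩
    have h := (helixPt_injective hn).image_injective hx
    obtain ⟨h1, h2, h3, -⟩ := nearest_eq_of_four_mem hn (x := x) hab hbc hcd (by rw [← h]; simp)
      (by rw [← h]; simp) (by rw [← h]; simp) (by rw [← h]; simp)
    exact ⟨by omega, by omega, h3⟩
  · rintro ⟨h1, h2, h3⟩
    obtain ⟨x, hx⟩ := exists_nearest_eq_four hn (a := a) (c := c) (by omega) (by omega)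
    obtain rfl : b = a + 1 := by omega
    obtain rfl : d = c + 1 := by omega
    rw [← hx]
    exact ⟨⟨x, by rw [hx]; simp, rfl⟩, affineIndependent_nearest hn x⟩

theorem delaunayIsTriangulation_helixSet {n : ℕ} (hn : 1 ≤ n) :
    DelaunayIsTriangulation (helixSet n) := by
  intro T hT
  refine ⟨hT, ?_⟩
  obtain ⟨x, -, rfl⟩ := isDelaunayCell_iff.1 hT
  exact affineIndependent_nearest hn x

theorem lemma2 (n : ℕ) (hn : 1 ≤ n) :
    -- the Delaunay triangulation of `H_n`
    DelaunayIsTriangulation (helixSet n) ∧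
    (∀ a b c d : ℤ, a < b → b < c → c < d →
      (IsDelaunaySimplex (helixSet n) {helixPt n a, helixPt n b, helixPt n c, helixPt n d} ↔
        b - a = 1 ∧ d - c = 1 ∧ d - a ≤ (n : ℤ))) ∧
    -- each Voronoi region is a polyhedron with exactly `2n` facets, in `n` symmetric pairs
    (∀ t : ℤ,
      IsPolyhedron (helixRegion n t) ∧ affDim (helixRegion n t) = 3 ∧
      facets (helixRegion n t) = helixFacet n t '' {k : ℤ | 1 ≤ |k| ∧ |k| ≤ (n : ℤ)} ∧
      (facets (helixRegion n t)).encard = 2 * n ∧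
      (∃ σ : E3 ≃ᵃⁱ[ℝ] E3, (∀ x, σ (σ x) = x) ∧ σ '' helixRegion n t = helixRegion n t ∧
        ∀ k : ℤ, σ '' helixFacet n t k = helixFacet n t (-k))) ∧
    -- the shapes and adjacencies of the facets
    (4 ≤ n → ∀ t : ℤ,
      (∀ k : ℤ, |k| = 1 →
        BoundedBy (helixFacet n t k) (2 * n - 4) 2 ∧ ParallelRays (helixFacet n t k)) ∧
      (∀ k : ℤ, |k| = 2 → BoundedBy (helixFacet n t k) 3 0) ∧
      (∀ k : ℤ, 3 ≤ |k| → |k| ≤ (n : ℤ) - 2 → BoundedBy (helixFacet n t k) 4 0) ∧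
      (∀ k : ℤ, |k| = (n : ℤ) - 1 →
        BoundedBy (helixFacet n t k) 2 2 ∧ ParallelRays (helixFacet n t k)) ∧
      (∀ k : ℤ, |k| = (n : ℤ) → BoundedBy (helixFacet n t k) 0 2) ∧
      (affineSpan ℝ (helixFacet n t (n : ℤ))).Parallel
        (affineSpan ℝ (helixFacet n t (-(n : ℤ)))) ∧
      (∀ x : E3, IsFace (helixRegion n t) {x} 0 →
        x ∈ helixFacet n t 1 ∨ x ∈ helixFacet n t (-1)) ∧
      (∀ j : ℤ, 1 ≤ |j| → |j| ≤ (n : ℤ) → j ≠ 1 →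
        (AdjacentFacets (helixFacet n t 1) (helixFacet n t j) ↔ j ≠ -(n : ℤ))) ∧
      (∀ j : ℤ, 1 ≤ |j| → |j| ≤ (n : ℤ) → j ≠ -1 →
        (AdjacentFacets (helixFacet n t (-1)) (helixFacet n t j) ↔ j ≠ (n : ℤ))) ∧
      (∀ i j : ℤ, 2 ≤ |i| → |i| ≤ (n : ℤ) → 2 ≤ |j| → |j| ≤ (n : ℤ) → i ≠ j →
        (AdjacentFacets (helixFacet n t i) (helixFacet n t j) ↔ |i - j| = 1))) := by
  refine ⟨delaunayIsTriangulation_helixSet hn, fun a b c d => isDelaunaySimplex_four_iff hn,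
    fun t => ⟨isPolyhedron_helixRegion hn t, affDim_helixRegion hn t, facets_helixRegion hn t,
      encard_facets_helixRegion hn t, exists_symmetry n t⟩,
    fun hn4 t => ⟨fun k hk => ⟨boundedBy_one hn4 t hk, parallelRays_one hn4 t hk⟩,
      fun k hk => boundedBy_two hn4 t hk, fun k h3 hk => boundedBy_middle t h3 hk,
      fun k hk => ⟨boundedBy_sub_one hn4 t hk, parallelRays_sub_one hn4 t hk⟩,
      fun k hk => boundedBy_turn hn4 t hk, parallel_affineSpan_turn hn t,
      fun x hx => mem_helixFacet_one_of_vertex hn t hx, fun j hj hjn h1 => ?_,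
      fun j hj hjn h1 => ?_, fun i j hi hin hj hjn hij => ?_⟩⟩
  -- The pair 0, 1 is consecutive, so only the span can fail, and it does so just for j = -n.
  · rw [le_abs] at hj
    rw [abs_le] at hjn
    rw [adjacentFacets_iff (by omega) t (by omega) (by omega) (Ne.symm h1)]
    unfold IsHelixTriple
    omega
  · rw [le_abs] at hj
    rw [abs_le] at hjn
    rw [adjacentFacets_iff (by omega) t (by omega) (by omega) (Ne.symm h1)]
    unfold IsHelixTriple
    omega
  -- Neither i nor j is next to 0, so the required consecutive pair must be i, j itself.
  · rw [le_abs] at hi hj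
    rw [abs_le] at hin hjn
    rw [adjacentFacets_iff (by omega) t (by omega) (by omega) hij, abs_eq one_pos.le]
    unfold IsHelixTriple
    omega
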